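/- Work in the Euclidean plane $\mathbb{R}^2$ and let $0<\delta\le 1$, $D=\delta^{-1}$. A $\delta$-ball is a (closed) ball of radius $\delta$ and a $\delta$-tube is a $\delta\times 1$ rectangle in arbitrary position. Two $\delta$-balls (or two $\delta$-tubes) are essentially distinct if their intersection has at most half of the area of each. For $K\ge 1$: (i) a finite set $P$ of $\delta$-balls contained in $[0,1]^2$ is a $(\delta,\beta,K)$-set of balls if $\#\{p\in P: p\subset B\}\le K(w/\delta)^\beta$ for every $w\in[\delta,1]$ and every ball $B$ of radius $w$; (ii) a finite set $\mathbb{T}$ of pairwise essentially distinct $\delta$-tubes contained in $[0,1]^2$ is a $(\delta,\alpha,K)$-set of tubes if $\#\{t\in\mathbb{T}: t\subset R\}\le K(w/\delta)^\alpha$ for every $w\in[\delta,1]$ and every $w\times 2$ rectangle $R$. Let $c>0$. A finite collection $P$ of pairwise essentially distinct $\delta$-balls is a $(\delta,u,v,K_u,K_v)$-Furstenberg set (with implied constant $c$) if there is a $(\delta,v,K_v)$-set of tubes $\mathbb{T}$ with $|\mathbb{T}|\ge c\,D^v$ such that for each $t\in\mathbb{T}$ the set $P_t=\{p\in P: p\cap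 t\ne\emptyset\}$ is a $(\delta,u,K_u)$-set of balls with $|P_t|\ge c\,K_u^{-1}D^u$. Theorem. For every $\varepsilon>0$ and $c>0$ there is a constant $C=C(\varepsilon,c)>0$ such that for all $1\le v\le 2$, $0<u\le 1$, $0<\delta\le 1$, $K_u,K_v\ge 1$, every $(\delta,u,v,K_u,K_v)$-Furstenberg set $P$ with implied constant $c$ satisfies $$|P|\ \ge\ C\,K_u^{-3}\,K_v^{-1}\,D^{\min(2u+v-1,\;u+1)-\varepsilon}.$$ -/

import Mathlib

noncomputable section

open scoped Classical

namespace Furstenberg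

/-- The Euclidean plane. -/
abbrev Plane : Type := EuclideanSpace ℝ (Fin 2)

/-- The square `[0,1]²`. -/
def unitSquare : Set Plane := {x | ∀ i, x i ∈ Set.Icc (0 : ℝ) 1}

/-- A (closed) ball of radius `r` in the plane. -/
def IsBall (r : ℝ) (p : Set Plane) : Prop :=
  ∃ x : Plane, p = Metric.closedBall x r

/-- A (closed) `a × b` rectangle in the plane, in arbitrary position: `x` is its centre, and the
orthonormal vectors `e`, `f` are the directions of the sides of lengths `a`, `b`. -/
def IsRectangle (a b : ℝ) (R : Set Plane) : Prop :=
  ∃ x e f : Plane, ‖e‖ = 1 ∧ ‖f‖ = 1 ∧ inner ℝ e f = 0 ∧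
    R = {y | |inner ℝ (y - x) e| ≤ a / 2 ∧ |inner ℝ (y - x) f| ≤ b / 2}

/-- A `δ`-tube is a `δ × 1` rectangle. -/
def IsTube (δ : ℝ) (t : Set Plane) : Prop := IsRectangle δ 1 t

/-- Two congruent sets are essentially distinct if their intersection has at most half of the
area of each of them. -/
def EssentiallyDistinct (s t : Set Plane) : Prop :=
  MeasureTheory.volume (s ∩ t) ≤ MeasureTheory.volume s / 2 ∧
  MeasureTheory.volume (s ∩ t) ≤ MeasureTheory.volume t / 2

/-- `(δ, β, K)`-sets of balls. -/
structure IsBallSet (δ β K : ℝ) (P : Finset (Set Plane)) : Prop where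
  isBall : ∀ p ∈ P, IsBall δ p
  subset_square : ∀ p ∈ P, p ⊆ unitSquare
  spacing : ∀ w ∈ Set.Icc δ 1, ∀ B : Set Plane, IsBall w B →
    ((P.filter (fun p => p ⊆ B)).card : ℝ) ≤ K * (w / δ) ^ β

/-- `(δ, α, K)`-sets of tubes. -/
structure IsTubeSet (δ α K : ℝ) (T : Finset (Set Plane)) : Prop where
  isTube : ∀ t ∈ T, IsTube δ t
  subset_square : ∀ t ∈ T, t ⊆ unitSquare
  essentiallyDistinct : (T : Set (Set Plane)).Pairwise EssentiallyDistinct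
  spacing : ∀ w ∈ Set.Icc δ 1, ∀ R : Set Plane, IsRectangle w 2 R →
    ((T.filter (fun t => t ⊆ R)).card : ℝ) ≤ K * (w / δ) ^ α

/-- The members of `P` that meet `t`. -/
def meeting (P : Finset (Set Plane)) (t : Set Plane) : Finset (Set Plane) :=
  P.filter (fun p => (p ∩ t).Nonempty)

/-- Discretized `(δ, u, v, Ku, Kv)`-Furstenberg sets of `δ`-balls, where `c` is the constant implied
in the two lower bounds `|T| ≳ δ⁻ᵛ` and `|P_t| ≳ Ku⁻¹ δ⁻ᵘ`. -/
def IsFurstenbergSet (c δ u v Ku Kv : ℝ) (P : Finset (Set Plane)) : Prop :=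
  (∀ p ∈ P, IsBall δ p) ∧
  (P : Set (Set Plane)).Pairwise EssentiallyDistinct ∧
  ∃ T : Finset (Set Plane), IsTubeSet δ v Kv T ∧
    c * δ⁻¹ ^ v ≤ (T.card : ℝ) ∧
    ∀ t ∈ T, IsBallSet δ u Ku (meeting P t) ∧
      c * (Ku⁻¹ * δ⁻¹ ^ u) ≤ ((meeting P t).card : ℝ)

end Furstenberg

end

namespace Furstenberg

noncomputable section

open MeasureTheory Metric Set

open scoped Classical

/-! The engine is an `L²` argument in the space of lines `y = a x + b`, with coordinates `(a, b)`.
Each point contributes a bump supported near the set of lines through it; `F` is the sum of these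
bumps, and counting incidences with a family of tubes means evaluating `F` at their core lines. `F`
is decomposed over dyadic scales by differences of averages over squares. The coarsest average
yields the expected count, the number of pairs times the scale. The part at scale `2⁻ⁱ` is built
from profiles of mean zero, so the inner product of two of them decays like the inverse square of
the distance of the points (`abs_kernel_le_of_dist`). For points that are Frostman of dimension `m ≤
2` this bounds its `L²` norm (`sum_abs_kernel_le`), and the spacing of the tubes turns the norm into
a bound for a sum over the tubes (`sum_sq_boxAvg_le`). The outcome is `incidence_le`.

The set `P` itself need not be Frostman. Among all covers of `P` by dyadic cells, where a cell of
side `2⁻ʲ` costs about `(2⁻ʲ / δ) ^ m`, a cheapest one is Frostman of dimension `m` on each level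
and costs at most `|P|` (`exists_minimal_cover`). The spacing of the balls along each tube limits
how many of them one cell can hold, so some level carries a logarithmic share of all incidences
(`IsConfiguration.exists_level`). There `incidence_le` forces many cells, and their cost bounds
`|P|` from below.

At level `j` the square of the error term carries the factor `(2 ^ j) ^ max m (3 - v)`. The
exponents balance as long as `m + max m (3 - v) ≤ 2 u + 2`, which says precisely `m ≤ min (2 u + v -
1) (u + 1)`. The loss `D ^ ε` pays for powers of the number of scales. -/

/-! ### Covers of minimal cost -/

/-- A cover of `P` by cells of minimal cost `∑ φ (level)` is a Frostman set at every level: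
among the chosen cells of level `j`, at most `φ l / φ j` lie in a common cell of level `l`. -/
theorem exists_minimal_cover {κ β : Type*} [DecidableEq β] (P : Finset κ) (n : ℕ) (cell : ℕ → κ → β)
    (hcell : ∀ l j p q, l ≤ j → cell j p = cell j q → cell l p = cell l q)
    (φ : ℕ → ℝ) (hφ : ∀ j, 0 ≤ φ j) :
    ∃ Z : ℕ → Finset κ, (∀ j, Z j ⊆ P) ∧
      (∀ p ∈ P, ∃ j ≤ n, ∃ z ∈ Z j, cell j z = cell j p) ∧
      (∀ l j, l ≤ j → j ≤ n → ∀ k,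
        φ j * (((Z j).filter (fun z => cell l z = k)).card : ℝ) ≤ φ l) ∧
      ∀ j ≤ n, φ j * ((Z j).card : ℝ) ≤ φ n * (P.card : ℝ) := by
  -- A pair `(j, p)` names the cell of level `j` around `p`, so that a cover is just a finite set of
  -- pairs.
  set U : Finset (ℕ × κ) := Finset.range (n + 1) ×ˢ P with hU
  set cost : Finset (ℕ × κ) → ℝ := fun Q => ∑ x ∈ Q, φ x.1 with hcost
  set covers : Finset (ℕ × κ) → Prop :=
    fun Q => ∀ p ∈ P, ∃ x ∈ Q, cell x.1 x.2 = cell x.1 p with hcovers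
  have hfine : ({n} ×ˢ P : Finset (ℕ × κ)) ∈ U.powerset.filter covers := by
    rw [Finset.mem_filter, Finset.mem_powerset]
    refine ⟨Finset.product_subset_product_left (by simp), fun p hp => ⟨(n, p), by simp [hp], rfl⟩⟩
  obtain ⟨Q, hQ, hmin⟩ := Finset.exists_min_image (U.powerset.filter covers) cost ⟨_, hfine⟩
  rw [Finset.mem_filter, Finset.mem_powerset] at hQ
  obtain ⟨hQU, hQc⟩ := hQ
  have hmem : ∀ x ∈ Q, x.1 ≤ n ∧ x.2 ∈ P := fun x hx => by
    have := hQU hx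
    rw [hU, Finset.mem_product, Finset.mem_range] at this
    exact ⟨by omega, this.2⟩
  refine ⟨fun j => P.filter (fun z => (j, z) ∈ Q), fun j => Finset.filter_subset _ _, ?_, ?_, ?_⟩
  · intro p hp
    obtain ⟨x, hx, hxp⟩ := hQc p hp
    exact ⟨x.1, (hmem x hx).1, x.2, by simp [(hmem x hx).2, hx], hxp⟩
  · intro l j hlj hjn k
    set S := (P.filter (fun z => (j, z) ∈ Q)).filter (fun z => cell l z = k) with hS
    rcases S.eq_empty_or_nonempty with h0 | ⟨z₀, hz₀⟩
    · rw [h0]; simpa using hφ l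
    have hSmem : ∀ z, z ∈ S ↔ z ∈ P ∧ (j, z) ∈ Q ∧ cell l z = k := fun z => by
      rw [hS, Finset.mem_filter, Finset.mem_filter, and_assoc]
    have hSQ : ({j} ×ˢ S : Finset (ℕ × κ)) ⊆ Q := by
      rintro ⟨i, z⟩ hx
      rw [Finset.mem_product, Finset.mem_singleton] at hx
      obtain ⟨rfl, hz⟩ := hx
      exact ((hSmem z).1 hz).2.1
    -- The competitor: all chosen cells of level `j` inside the cell `k` of level `l` are exchanged
    -- for that one larger cell. It still covers `P`, so it cannot be cheaper.
    have hnew := hmin (insert (l, z₀) (Q \ ({j} ×ˢ S))) (by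
      rw [Finset.mem_filter, Finset.mem_powerset]
      refine ⟨Finset.insert_subset ?_ (Finset.sdiff_subset.trans hQU), fun p hp => ?_⟩
      · rw [hU, Finset.mem_product, Finset.mem_range]
        exact ⟨by dsimp only; omega, ((hSmem z₀).1 hz₀).1⟩
      · obtain ⟨x, hx, hxp⟩ := hQc p hp
        by_cases hxS : x ∈ ({j} ×ˢ S : Finset (ℕ × κ))
        · rw [Finset.mem_product, Finset.mem_singleton] at hxS
          refine ⟨(l, z₀), Finset.mem_insert_self _ _, ?_⟩
          rw [hxS.1] at hxp
          rw [← hcell l j _ _ hlj hxp, ((hSmem _).1 hxS.2).2.2, ((hSmem z₀).1 hz₀).2.2]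
        · exact ⟨x, Finset.mem_insert_of_mem (Finset.mem_sdiff.2 ⟨hx, hxS⟩), hxp⟩)
    have h1 : cost (insert (l, z₀) (Q \ ({j} ×ˢ S))) ≤ φ l + cost (Q \ ({j} ×ˢ S)) := by
      by_cases h : (l, z₀) ∈ Q \ ({j} ×ˢ S)
      · rw [Finset.insert_eq_of_mem h]; linarith [hφ l]
      · simp only [hcost]; rw [Finset.sum_insert h]
    have h2 : cost (Q \ ({j} ×ˢ S)) + cost ({j} ×ˢ S) = cost Q := Finset.sum_sdiff hSQ
    have h3 : cost ({j} ×ˢ S) = φ j * (S.card : ℝ) := by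
      simp only [hcost]
      rw [Finset.sum_product]
      simp [mul_comm]
    linarith
  · intro j hj
    have h1 : cost ({n} ×ˢ P) = φ n * (P.card : ℝ) := by
      simp only [hcost]
      rw [Finset.sum_product]
      simp [mul_comm]
    have h2 : cost ({j} ×ˢ (P.filter (fun z => (j, z) ∈ Q)))
        = φ j * ((P.filter (fun z => (j, z) ∈ Q)).card : ℝ) := by
      simp only [hcost]
      rw [Finset.sum_product]
      simp [mul_comm]
    have h3 : cost ({j} ×ˢ (P.filter (fun z => (j, z) ∈ Q))) ≤ cost Q := by
      refine Finset.sum_le_sum_of_subset_of_nonneg ?_ (fun x _ _ => hφ x.1)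
      rintro ⟨i, z⟩ hx
      rw [Finset.mem_product, Finset.mem_singleton] at hx
      obtain ⟨rfl, hz⟩ := hx
      exact (Finset.mem_filter.1 hz).2
    rw [← h2, ← h1]
    exact h3.trans (hmin _ hfine)

/-! ### Averages over squares in the space of lines -/

/-- The average of `H` over the square of side `2w` centred at `t`. -/
def boxAvg (w : ℝ) (H : ℝ × ℝ → ℝ) (t : ℝ × ℝ) : ℝ :=
  (4 * w ^ 2)⁻¹ * ∫ z in closedBall (0 : ℝ × ℝ) w, H (t + z)

theorem volume_real_box (t : ℝ × ℝ) {w : ℝ} (hw : 0 ≤ w) :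
    volume.real (closedBall t w) = 4 * w ^ 2 := by
  rcases t with ⟨a, b⟩
  rw [← closedBall_prod_same, Measure.volume_eq_prod, measureReal_prod_prod, Real.closedBall_eq_Icc,
    Real.closedBall_eq_Icc, Real.volume_real_Icc_of_le (by linarith),
    Real.volume_real_Icc_of_le (by linarith)]
  ring

theorem continuous_boxAvg (w : ℝ) {H : ℝ × ℝ → ℝ} (hH : Continuous H) :
    Continuous (boxAvg w H) := by
  refine continuous_const.mul ?_
  exact continuous_parametric_integral_of_continuous (f := fun t z => H (t + z))
    (hH.comp (continuous_fst.add continuous_snd)) (isCompact_closedBall _ _)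

theorem integrableOn_box {H : ℝ × ℝ → ℝ} (hH : Continuous H) (t : ℝ × ℝ) (w : ℝ) :
    IntegrableOn H (closedBall t w) :=
  hH.continuousOn.integrableOn_compact (isCompact_closedBall _ _)

theorem integrableOn_box_add {H : ℝ × ℝ → ℝ} (hH : Continuous H) (s t : ℝ × ℝ) (w : ℝ) :
    IntegrableOn (fun z => H (s + z)) (closedBall t w) :=
  integrableOn_box (H := fun z => H (s + z)) (by fun_prop) t w

theorem boxAvg_sub (w : ℝ) {H G : ℝ × ℝ → ℝ} (hH : Continuous H) (hG : Continuous G) :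
    boxAvg w (fun t => H t - G t) = fun t => boxAvg w H t - boxAvg w G t := by
  funext t
  simp only [boxAvg]
  rw [integral_sub (integrableOn_box_add hH t 0 w) (integrableOn_box_add hG t 0 w), mul_sub]

theorem boxAvg_sum {κ : Type*} (w : ℝ) (Z : Finset κ) {H : κ → ℝ × ℝ → ℝ}
    (hH : ∀ q, Continuous (H q)) :
    boxAvg w (fun t => ∑ q ∈ Z, H q t) = fun t => ∑ q ∈ Z, boxAvg w (H q) t := by
  funext t
  simp only [boxAvg]
  rw [integral_finsetSum _ (fun q _ => integrableOn_box_add (hH q) t 0 w), Finset.mul_sum]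

/-- Fubini. Commutation lets a difference of squared averaging operators factor in `incidence_le`.
-/
theorem boxAvg_comm (w w' : ℝ) {H : ℝ × ℝ → ℝ} (hH : Continuous H) :
    boxAvg w (boxAvg w' H) = boxAvg w' (boxAvg w H) := by
  funext t
  simp only [boxAvg]
  rw [integral_const_mul, integral_const_mul, integral_integral_swap]
  · simp only [add_right_comm t]; ring
  · rw [Measure.prod_restrict]
    refine ContinuousOn.integrableOn_compact
      ((isCompact_closedBall _ _).prod (isCompact_closedBall _ _)) ?_
    exact Continuous.continuousOn (by simp only [Function.uncurry_def]; fun_prop)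

theorem boxAvg_mono {w : ℝ} {H G : ℝ × ℝ → ℝ} (hH : Continuous H) (hG : Continuous G)
    (t : ℝ × ℝ) (h : ∀ z ∈ closedBall t w, H z ≤ G z) : boxAvg w H t ≤ boxAvg w G t := by
  refine mul_le_mul_of_nonneg_left ?_ (by positivity)
  refine setIntegral_mono_on (integrableOn_box_add hH t 0 w) (integrableOn_box_add hG t 0 w)
    measurableSet_closedBall fun z hz => h _ ?_
  rw [mem_closedBall, dist_eq_norm] at *
  simpa using hz

theorem boxAvg_const {w : ℝ} (hw : 0 < w) (c : ℝ) (t : ℝ × ℝ) : boxAvg w (fun _ => c) t = c := by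
  simp only [boxAvg]
  rw [setIntegral_const, volume_real_box _ hw.le, smul_eq_mul, ← mul_assoc,
    inv_mul_cancel₀ (by positivity), one_mul]

theorem boxAvg_eq {w : ℝ} (H : ℝ × ℝ → ℝ) (t : ℝ × ℝ) :
    boxAvg w H t = (4 * w ^ 2)⁻¹ * ∫ z in closedBall t w, H z := by
  simp only [boxAvg]
  rw [← integral_indicator measurableSet_closedBall, ← integral_indicator measurableSet_closedBall,
    ← integral_add_left_eq_self (μ := volume) ((closedBall t w).indicator H) t]
  congr 2
  funext z
  simp only [indicator, mem_closedBall, dist_eq_norm, sub_zero, add_sub_cancel_left]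

/-- Jensen's inequality, from averaging `0 ≤ (H - A) ^ 2` with `A` the mean of `H`. -/
theorem sq_boxAvg_le {w : ℝ} (hw : 0 < w) {H : ℝ × ℝ → ℝ} (hH : Continuous H) (t : ℝ × ℝ) :
    boxAvg w H t ^ 2 ≤ (4 * w ^ 2)⁻¹ * ∫ z in closedBall t w, H z ^ 2 := by
  set A := boxAvg w H t with hA
  have h1 : boxAvg w (fun z => 2 * A * H z - A ^ 2) t ≤ boxAvg w (fun z => H z ^ 2) t :=
    boxAvg_mono (by fun_prop) (by fun_prop) t (fun z _ => by nlinarith [sq_nonneg (H z - A)])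
  rw [boxAvg_sub w (H := fun z => 2 * A * H z) (by fun_prop) continuous_const] at h1
  simp only [boxAvg_const hw] at h1
  have h2 : boxAvg w (fun z => 2 * A * H z) t = 2 * A * A := by
    rw [hA]
    simp only [boxAvg]
    rw [integral_const_mul]
    ring
  rw [h2, boxAvg_eq (fun z => H z ^ 2) t] at h1
  nlinarith

/-- A tent function, the cut-off in the slope variable. -/
def slopeCutoff (a : ℝ) : ℝ := max 0 (1 - |a| / 4)

theorem continuous_slopeCutoff : Continuous slopeCutoff := by
  unfold slopeCutoff
  fun_prop

theorem slopeCutoff_nonneg (a : ℝ) : 0 ≤ slopeCutoff a := le_max_left _ _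

theorem slopeCutoff_le_one (a : ℝ) : slopeCutoff a ≤ 1 :=
  max_le zero_le_one (by linarith [abs_nonneg a])

theorem slopeCutoff_eq_zero {a : ℝ} (ha : 4 ≤ |a|) : slopeCutoff a = 0 :=
  max_eq_left (by linarith)

theorem half_le_slopeCutoff {a : ℝ} (ha : |a| ≤ 2) : 1 / 2 ≤ slopeCutoff a :=
  le_max_of_le_right (by linarith)

/-- This Lipschitz bound is all the smoothness of the cut-off that the decay of the kernel needs. -/
theorem abs_slopeCutoff_sub_le (a b : ℝ) : |slopeCutoff a - slopeCutoff b| ≤ |a - b| := by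
  unfold slopeCutoff
  refine (abs_max_sub_max_le_max _ _ _ _).trans ?_
  rw [sub_self, abs_zero, max_eq_right (abs_nonneg _)]
  have : 1 - |a| / 4 - (1 - |b| / 4) = (|b| - |a|) / 4 := by ring
  rw [this, abs_div, abs_of_pos (show (0 : ℝ) < 4 by norm_num), ← abs_sub_comm b a]
  linarith [abs_abs_sub_abs_le b a, abs_nonneg (b - a)]

/-- If every square of side `2w` contains at most `N` of the lines `ℓ t`, the averages of `H` around
these lines are controlled in the square mean by the `L²` norm of `H`. -/
theorem sum_sq_boxAvg_le {ι : Type*} (T : Finset ι) (ℓ : ι → ℝ × ℝ) {w N : ℝ} (hw : 0 < w)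
    (hw1 : w ≤ 1) (hℓ : ∀ t ∈ T, |(ℓ t).1| ≤ 1)
    (hN : ∀ z : ℝ × ℝ, ((T.filter (fun t => z ∈ closedBall (ℓ t) w)).card : ℝ) ≤ N)
    {H : ℝ × ℝ → ℝ} (hH : Continuous H)
    (hint : Integrable (fun z : ℝ × ℝ => slopeCutoff z.1 * H z ^ 2)) :
    ∑ t ∈ T, boxAvg w H (ℓ t) ^ 2 ≤ w⁻¹ ^ 2 * N * ∫ z : ℝ × ℝ, slopeCutoff z.1 * H z ^ 2 := by
  have hH2 : Continuous fun z => H z ^ 2 := by fun_prop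
  have hN0 : 0 ≤ N := (Nat.cast_nonneg _).trans (hN 0)
  have hpt : ∀ z : ℝ × ℝ, ∑ t ∈ T, (closedBall (ℓ t) w).indicator (fun z => H z ^ 2) z
      ≤ 2 * N * (slopeCutoff z.1 * H z ^ 2) := by
    intro z
    have h1 : ∑ t ∈ T, (closedBall (ℓ t) w).indicator (fun z => H z ^ 2) z
        = ((T.filter (fun t => z ∈ closedBall (ℓ t) w)).card : ℝ) * H z ^ 2 := by
      simp only [indicator]
      rw [← Finset.sum_filter, Finset.sum_const, nsmul_eq_mul]
    rw [h1]
    rcases (T.filter (fun t => z ∈ closedBall (ℓ t) w)).eq_empty_or_nonempty with h0 | ⟨t, ht⟩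
    · rw [h0]
      have := slopeCutoff_nonneg z.1
      simp only [Finset.card_empty, Nat.cast_zero, zero_mul]
      positivity
    · rw [Finset.mem_filter, mem_closedBall, dist_eq_norm] at ht
      have h2 : |z.1 - (ℓ t).1| ≤ w := (norm_fst_le (z - ℓ t)).trans ht.2
      have h3 : |z.1| ≤ 2 := by
        have := abs_add_le (z.1 - (ℓ t).1) (ℓ t).1
        rw [sub_add_cancel] at this
        linarith [hℓ t ht.1]
      have h4 := half_le_slopeCutoff h3
      have h5 := mul_le_mul_of_nonneg_right (hN z) (sq_nonneg (H z))
      nlinarith [mul_nonneg hN0 (sq_nonneg (H z))]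
  have hind : ∀ t ∈ T, Integrable ((closedBall (ℓ t) w).indicator (fun z => H z ^ 2)) :=
    fun t _ => (integrableOn_box hH2 _ _).integrable_indicator measurableSet_closedBall
  calc ∑ t ∈ T, boxAvg w H (ℓ t) ^ 2
      ≤ ∑ t ∈ T, (4 * w ^ 2)⁻¹ * ∫ z, (closedBall (ℓ t) w).indicator (fun z => H z ^ 2) z := by
        refine Finset.sum_le_sum fun t _ => ?_
        rw [integral_indicator measurableSet_closedBall]
        exact sq_boxAvg_le hw hH _
    _ = (4 * w ^ 2)⁻¹ * ∫ z, ∑ t ∈ T, (closedBall (ℓ t) w).indicator (fun z => H z ^ 2) z := by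
        rw [integral_finsetSum _ hind, Finset.mul_sum]
    _ ≤ (4 * w ^ 2)⁻¹ * ∫ z : ℝ × ℝ, 2 * N * (slopeCutoff z.1 * H z ^ 2) := by
        refine mul_le_mul_of_nonneg_left ?_ (by positivity)
        exact integral_mono (integrable_finsetSum _ hind) (hint.const_mul _) hpt
    _ ≤ _ := by
        rw [integral_const_mul]
        have h0 : 0 ≤ ∫ z : ℝ × ℝ, slopeCutoff z.1 * H z ^ 2 :=
          integral_nonneg fun z => mul_nonneg (slopeCutoff_nonneg _) (sq_nonneg _)
        have : (4 * w ^ 2)⁻¹ * (2 * N * ∫ z : ℝ × ℝ, slopeCutoff z.1 * H z ^ 2)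
            = 2⁻¹ * (w⁻¹ ^ 2 * N * ∫ z : ℝ × ℝ, slopeCutoff z.1 * H z ^ 2) := by
          rw [mul_inv, inv_pow]; ring
        rw [this]
        have : 0 ≤ w⁻¹ ^ 2 * N * ∫ z : ℝ × ℝ, slopeCutoff z.1 * H z ^ 2 := by positivity
        linarith

/-! ### The interaction kernel of two points -/

theorem hasCompactSupport_of_abs_le {ψ : ℝ → ℝ} {L : ℝ} (hsupp : ∀ s, L < |s| → ψ s = 0) :
    HasCompactSupport ψ :=
  HasCompactSupport.intro (isCompact_Icc (a := -L) (b := L)) fun s hs =>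
    hsupp s (by by_contra h; exact hs (abs_le.1 (not_lt.1 h)))

theorem integrable_of_abs_le {ψ : ℝ → ℝ} {L : ℝ} (hψ : Continuous ψ)
    (hsupp : ∀ s, L < |s| → ψ s = 0) : Integrable ψ :=
  hψ.integrable_of_hasCompactSupport (hasCompactSupport_of_abs_le hsupp)

theorem integrable_of_abs_le_prod {F : ℝ × ℝ → ℝ} {A B : ℝ} (hF : Continuous F)
    (hA : ∀ z, A < |z.1| → F z = 0) (hB : ∀ z, |z.1| ≤ A → B < |z.2| → F z = 0) :
    Integrable F (volume.prod volume) := by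
  refine hF.integrable_of_hasCompactSupport (HasCompactSupport.intro
    ((isCompact_Icc (a := -A) (b := A)).prod (isCompact_Icc (a := -B) (b := B))) fun z hz => ?_)
  by_contra h
  refine hz ⟨abs_le.1 (not_lt.1 fun h' => h (hA z h')), abs_le.1 (not_lt.1 fun h' => h (hB z ?_ h'))⟩
  exact not_lt.1 fun h' => h (hA z h')

theorem integral_comp_sub_mul (ψ : ℝ → ℝ) (s d : ℝ) :
    ∫ a, ψ (s - a * d) = |d⁻¹| * ∫ a, ψ a := by
  have := Measure.integral_comp_mul_left (fun u => ψ (s - u)) d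
  rw [integral_sub_left_eq_self ψ volume s, smul_eq_mul] at this
  simpa only [mul_comm d] using this

theorem continuous_cutoff_mul {ψ : ℝ → ℝ} (hψ : Continuous ψ) (s d : ℝ) :
    Continuous fun a => slopeCutoff a * ψ (s - a * d) :=
  continuous_slopeCutoff.mul (by fun_prop)

/-- The trivial bound for an integral along the slopes. -/
theorem abs_integral_cutoff_le {ψ : ℝ → ℝ} {M : ℝ} (hM : ∀ s, |ψ s| ≤ M) (s d : ℝ) :
    |∫ a, slopeCutoff a * ψ (s - a * d)| ≤ 8 * M := by
  have h : ∫ a, slopeCutoff a * ψ (s - a * d)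
      = ∫ a in Icc (-4 : ℝ) 4, slopeCutoff a * ψ (s - a * d) := by
    refine (setIntegral_eq_integral_of_forall_compl_eq_zero fun a ha => ?_).symm
    rw [slopeCutoff_eq_zero, zero_mul]
    by_contra h
    exact ha (abs_le.1 (not_le.1 h).le)
  rw [h]
  have h1 := norm_setIntegral_le_of_norm_le_const (μ := volume) (s := Icc (-4 : ℝ) 4)
    (f := fun a => slopeCutoff a * ψ (s - a * d)) (C := M) isCompact_Icc.measure_lt_top
    (fun a _ => by
      rw [Real.norm_eq_abs, abs_mul, abs_of_nonneg (slopeCutoff_nonneg a)]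
      nlinarith [slopeCutoff_nonneg a, slopeCutoff_le_one a, hM (s - a * d),
        abs_nonneg (ψ (s - a * d))])
  rw [Real.norm_eq_abs, Real.volume_real_Icc_of_le (by norm_num)] at h1
  linarith

/-- The bound for an integral along the slopes that exploits the mean value zero. -/
theorem abs_integral_cutoff_le_of_integral_eq_zero {ψ : ℝ → ℝ} {L : ℝ} (hL : 0 ≤ L)
    (hψ : Continuous ψ)
    (hsupp : ∀ s, L < |s| → ψ s = 0) (h0 : ∫ s, ψ s = 0) (h1 : ∫ s, |ψ s| ≤ 2) (s : ℝ) {d : ℝ}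
    (hd : d ≠ 0) : |∫ a, slopeCutoff a * ψ (s - a * d)| ≤ 2 * L / d ^ 2 := by
  have hd' : 0 < |d| := abs_pos.2 hd
  have hsupp' : ∀ a, (L + |s|) / |d| < |a| → ψ (s - a * d) = 0 := fun a ha => hsupp _ (by
    rw [div_lt_iff₀ hd', ← abs_mul] at ha
    have := abs_sub_abs_le_abs_sub (a * d) s
    rw [abs_sub_comm] at this
    linarith)
  have hint : Integrable fun a => ψ (s - a * d) := integrable_of_abs_le (by fun_prop) hsupp'
  have hcut : Integrable fun a => slopeCutoff a * ψ (s - a * d) :=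
    integrable_of_abs_le (continuous_cutoff_mul hψ s d) fun a ha => by rw [hsupp' a ha, mul_zero]
  -- Since `ψ` has mean zero, a constant may be subtracted from the cut-off. The value at `a = s /
  -- d` is chosen because the integrand lives within `L / |d|` of that slope.
  have e : ∫ a, slopeCutoff a * ψ (s - a * d)
      = ∫ a, (slopeCutoff a - slopeCutoff (s / d)) * ψ (s - a * d) := by
    simp only [sub_mul]
    rw [integral_sub hcut (hint.const_mul _), integral_const_mul, integral_comp_sub_mul, h0]
    ring
  rw [e]
  calc |∫ a, (slopeCutoff a - slopeCutoff (s / d)) * ψ (s - a * d)|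
      ≤ ∫ a, L / |d| * |ψ (s - a * d)| := by
        rw [← Real.norm_eq_abs]
        refine norm_integral_le_of_norm_le (hint.abs.const_mul _) (Filter.Eventually.of_forall ?_)
        intro a
        rw [Real.norm_eq_abs, abs_mul]
        by_cases h : ψ (s - a * d) = 0
        · rw [h]; simp
        refine mul_le_mul_of_nonneg_right ?_ (abs_nonneg _)
        refine (abs_slopeCutoff_sub_le _ _).trans ?_
        rw [le_div_iff₀ hd', ← abs_mul, sub_mul, div_mul_cancel₀ _ hd, abs_sub_comm]
        exact not_lt.1 fun h' => h (hsupp _ h')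
    _ = L / |d| * (|d⁻¹| * ∫ a, |ψ a|) := by
        rw [integral_const_mul, integral_comp_sub_mul (fun u => |ψ u|)]
    _ ≤ L / |d| * (|d⁻¹| * 2) := by gcongr
    _ = 2 * L / d ^ 2 := by
        rw [abs_inv, ← sq_abs d]
        field_simp

theorem integral_cutoff_eq_zero {ψ : ℝ → ℝ} {L s d : ℝ} (hsupp : ∀ s, L < |s| → ψ s = 0)
    (h : L + 4 * |d| < |s|) : ∫ a, slopeCutoff a * ψ (s - a * d) = 0 := by
  have : (fun a => slopeCutoff a * ψ (s - a * d)) = fun _ => 0 := by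
    funext a
    rcases le_total 4 |a| with ha | ha
    · rw [slopeCutoff_eq_zero ha, zero_mul]
    · rw [hsupp, mul_zero]
      have h1 := abs_sub_abs_le_abs_sub s (a * d)
      rw [abs_mul] at h1
      nlinarith [abs_nonneg d]
  rw [this, integral_zero]

/-- The profile of a point on the space of lines: continuous, of bounded height and support. -/
structure IsProfile (L M : ℝ) (ψ : ℝ → ℝ) : Prop where
  continuous : Continuous ψ
  support : ∀ s, L < |s| → ψ s = 0
  bound : ∀ s, |ψ s| ≤ M
  mean : ∫ s, ψ s = 0
  mass : ∫ s, |ψ s| ≤ 2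

/-- The inner product of the functions which two points induce on the space of lines. -/
def kernel (ψ₁ ψ₂ : ℝ → ℝ) (x₁ y₁ x₂ y₂ : ℝ) : ℝ :=
  ∫ z : ℝ × ℝ, slopeCutoff z.1 * (ψ₁ (y₁ - z.1 * x₁ - z.2) * ψ₂ (y₂ - z.1 * x₂ - z.2))

theorem integrable_kernel {L M : ℝ} {ψ₁ ψ₂ : ℝ → ℝ} (h₁ : IsProfile L M ψ₁) (h₂ : IsProfile L M ψ₂)
    (x₁ y₁ x₂ y₂ : ℝ) : Integrable fun z : ℝ × ℝ =>
      slopeCutoff z.1 * (ψ₁ (y₁ - z.1 * x₁ - z.2) * ψ₂ (y₂ - z.1 * x₂ - z.2)) := by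
  have := h₁.continuous
  have := h₂.continuous
  have := continuous_slopeCutoff
  refine integrable_of_abs_le_prod (A := 4) (B := |y₁| + 4 * |x₁| + L) (by fun_prop) ?_ ?_
  · intro z hz; rw [slopeCutoff_eq_zero hz.le, zero_mul]
  · intro z hz1 hz2
    rw [h₁.support, zero_mul, mul_zero]
    have e1 := abs_sub_abs_le_abs_sub z.2 (y₁ - z.1 * x₁)
    have e2 := abs_sub y₁ (z.1 * x₁)
    rw [abs_mul] at e2
    rw [abs_sub_comm z.2] at e1
    nlinarith [abs_nonneg x₁]

/-- Replacing the intercept by `s = y₂ - a x₂ - b` isolates `ψ₂ s` from an integral over slopes that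
sees only the differences of the coordinates. -/
theorem kernel_eq {L M : ℝ} {ψ₁ ψ₂ : ℝ → ℝ} (h₁ : IsProfile L M ψ₁) (h₂ : IsProfile L M ψ₂)
    (x₁ y₁ x₂ y₂ : ℝ) : kernel ψ₁ ψ₂ x₁ y₁ x₂ y₂
      = ∫ s, (∫ a, slopeCutoff a * ψ₁ (y₁ - y₂ + s - a * (x₁ - x₂))) * ψ₂ s := by
  have c1 := h₁.continuous
  have c2 := h₂.continuous
  have c3 := continuous_slopeCutoff
  unfold kernel
  rw [Measure.volume_eq_prod, integral_prod _ (integrable_kernel h₁ h₂ x₁ y₁ x₂ y₂)]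
  have hint : Integrable (Function.uncurry fun a s =>
      slopeCutoff a * ψ₁ (y₁ - y₂ + s - a * (x₁ - x₂)) * ψ₂ s) (volume.prod volume) := by
    simp only [Function.uncurry_def]
    refine integrable_of_abs_le_prod (A := 4) (B := L) (by fun_prop) ?_ ?_
    · intro z hz; simp [slopeCutoff_eq_zero hz.le]
    · intro z _ hz; simp [h₂.support _ hz]
  simp only [← integral_mul_const]
  rw [← integral_integral_swap hint]
  congr 1
  funext a
  rw [← integral_sub_left_eq_self
    (fun s => slopeCutoff a * ψ₁ (y₁ - y₂ + s - a * (x₁ - x₂)) * ψ₂ s) volume (y₂ - a * x₂)]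
  congr 1
  funext b
  rw [show y₁ - y₂ + (y₂ - a * x₂ - b) - a * (x₁ - x₂) = y₁ - a * x₁ - b by ring, mul_assoc]

theorem abs_kernel_le_of_inner {L M E : ℝ} {ψ₁ ψ₂ : ℝ → ℝ} (h₁ : IsProfile L M ψ₁)
    (h₂ : IsProfile L M ψ₂) {x₁ y₁ x₂ y₂ : ℝ} (hE0 : 0 ≤ E)
    (hE : ∀ s, |s| ≤ L → |∫ a, slopeCutoff a * ψ₁ (y₁ - y₂ + s - a * (x₁ - x₂))| ≤ E) :
    |kernel ψ₁ ψ₂ x₁ y₁ x₂ y₂| ≤ 2 * E := by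
  rw [kernel_eq h₁ h₂]
  have hint : Integrable fun s => |ψ₂ s| := (integrable_of_abs_le h₂.continuous h₂.support).abs
  calc _ ≤ ∫ s, E * |ψ₂ s| := by
        rw [← Real.norm_eq_abs]
        refine norm_integral_le_of_norm_le (hint.const_mul _) (Filter.Eventually.of_forall ?_)
        intro s
        rw [Real.norm_eq_abs, abs_mul]
        by_cases h : ψ₂ s = 0
        · rw [h]; simp
        · exact mul_le_mul_of_nonneg_right (hE s (not_lt.1 fun h' => h (h₂.support s h')))
            (abs_nonneg _)
    _ = E * ∫ s, |ψ₂ s| := integral_const_mul _ _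
    _ ≤ E * 2 := mul_le_mul_of_nonneg_left h₂.mass hE0
    _ = 2 * E := mul_comm _ _

theorem abs_kernel_le {L M : ℝ} {ψ₁ ψ₂ : ℝ → ℝ} (h₁ : IsProfile L M ψ₁)
    (h₂ : IsProfile L M ψ₂) (x₁ y₁ x₂ y₂ : ℝ) : |kernel ψ₁ ψ₂ x₁ y₁ x₂ y₂| ≤ 16 * M := by
  have hM : 0 ≤ M := (abs_nonneg _).trans (h₁.bound 0)
  have := abs_kernel_le_of_inner h₁ h₂ (x₁ := x₁) (y₁ := y₁) (x₂ := x₂) (y₂ := y₂)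
    (E := 8 * M) (by positivity) (fun s _ => abs_integral_cutoff_le h₁.bound _ _)
  linarith

/-- The kernel decays quadratically in the distance of the points. -/
theorem abs_kernel_le_of_dist {L M ρ : ℝ} (hL : 0 < L) (hρ : 0 < ρ) {ψ₁ ψ₂ : ℝ → ℝ}
    (h₁ : IsProfile L M ψ₁) (h₂ : IsProfile L M ψ₂) {x₁ y₁ x₂ y₂ : ℝ}
    (hd : ρ ≤ |x₁ - x₂| ∨ ρ ≤ |y₁ - y₂|) :
    |kernel ψ₁ ψ₂ x₁ y₁ x₂ y₂| ≤ 256 * (L + L ^ 2 * M) / ρ ^ 2 := by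
  have hM : 0 ≤ M := (abs_nonneg _).trans (h₁.bound 0)
  -- If the points are separated too steeply, no slope in the support of the cut-off joins them and
  -- the kernel vanishes. Otherwise either `ρ ≤ 4 L`, where the trivial bound suffices, or `|x₁ -
  -- x₂| ≥ ρ / 8` and the cancellation in `ψ₁` applies.
  rcases lt_or_ge (2 * L + 4 * |x₁ - x₂|) |y₁ - y₂| with h | h
  · have h0 : |kernel ψ₁ ψ₂ x₁ y₁ x₂ y₂| ≤ 2 * 0 := by
      refine abs_kernel_le_of_inner h₁ h₂ le_rfl fun s hs => ?_
      rw [integral_cutoff_eq_zero h₁.support, abs_zero]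
      have := abs_sub_abs_le_abs_sub (y₁ - y₂) (-s)
      rw [abs_neg, sub_neg_eq_add] at this
      linarith
    rw [mul_zero] at h0
    exact h0.trans (by positivity)
  rcases le_or_gt ρ (4 * L) with h' | h'
  · refine (abs_kernel_le h₁ h₂ _ _ _ _).trans ?_
    rw [le_div_iff₀ (by positivity)]
    have : ρ ^ 2 ≤ (4 * L) ^ 2 := by gcongr
    nlinarith
  · have hx : ρ / 8 ≤ |x₁ - x₂| := by
      rcases hd with hd | hd <;> linarith
    have hx0 : x₁ - x₂ ≠ 0 := abs_pos.1 (by linarith)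
    have h2 : |kernel ψ₁ ψ₂ x₁ y₁ x₂ y₂| ≤ 2 * (2 * L / (x₁ - x₂) ^ 2) :=
      abs_kernel_le_of_inner h₁ h₂ (by positivity) fun s _ =>
        abs_integral_cutoff_le_of_integral_eq_zero hL.le h₁.continuous h₁.support h₁.mean h₁.mass _
          hx0
    refine h2.trans ?_
    have h3 : (ρ / 8) ^ 2 ≤ (x₁ - x₂) ^ 2 := by rw [← sq_abs (x₁ - x₂)]; gcongr
    calc 2 * (2 * L / (x₁ - x₂) ^ 2) ≤ 2 * (2 * L / (ρ / 8) ^ 2) := by gcongr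
      _ = 256 * L / ρ ^ 2 := by field_simp; ring
      _ ≤ _ := by gcongr; nlinarith [mul_nonneg (sq_nonneg L) hM]

/-! ### Profiles arising from averages -/

/-- The effect of `boxAvg` on a function of the signed vertical distance to a point. -/
def lineAvg (w x : ℝ) (g : ℝ → ℝ) (s : ℝ) : ℝ :=
  (4 * w ^ 2)⁻¹ * ∫ z in closedBall (0 : ℝ × ℝ) w, g (s - (z.1 * x + z.2))

theorem boxAvg_comp (w x y : ℝ) (g : ℝ → ℝ) :
    boxAvg w (fun t => g (y - t.1 * x - t.2)) = fun t => lineAvg w x g (y - t.1 * x - t.2) := by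
  funext t
  simp only [boxAvg, lineAvg, Prod.fst_add, Prod.snd_add]
  congr 2
  funext z
  congr 1
  ring

theorem continuous_lineAvg (w x : ℝ) {g : ℝ → ℝ} (hg : Continuous g) :
    Continuous (lineAvg w x g) := by
  refine continuous_const.mul ?_
  exact continuous_parametric_integral_of_continuous
    (f := fun (s : ℝ) (z : ℝ × ℝ) => g (s - (z.1 * x + z.2)))
    (by simp only [Function.uncurry_def]; fun_prop) (isCompact_closedBall _ _)

theorem lineAvg_nonneg (w x : ℝ) {g : ℝ → ℝ} (hg : ∀ s, 0 ≤ g s) (s : ℝ) : 0 ≤ lineAvg w x g s :=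
  mul_nonneg (by positivity) (integral_nonneg fun _ => hg _)

theorem abs_mul_add_le_of_mem_box {w x : ℝ} (hx : |x| ≤ 1) {z : ℝ × ℝ}
    (hz : z ∈ closedBall (0 : ℝ × ℝ) w) : |z.1 * x + z.2| ≤ 2 * w := by
  rw [mem_closedBall, dist_zero_right] at hz
  have h1 : |z.1| ≤ w := (norm_fst_le z).trans hz
  have h2 : |z.2| ≤ w := (norm_snd_le z).trans hz
  have h3 := abs_add_le (z.1 * x) z.2
  rw [abs_mul] at h3
  nlinarith [abs_nonneg z.1, abs_nonneg x]

theorem lineAvg_eq_zero {w x ρ : ℝ} (hx : |x| ≤ 1) {g : ℝ → ℝ}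
    (hsupp : ∀ s, ρ < |s| → g s = 0) {s : ℝ} (hs : ρ + 2 * w < |s|) : lineAvg w x g s = 0 := by
  unfold lineAvg
  rw [setIntegral_eq_zero_of_forall_eq_zero, mul_zero]
  intro z hz
  refine hsupp _ ?_
  have h1 := abs_mul_add_le_of_mem_box hx hz
  have h2 := abs_sub_abs_le_abs_sub s (z.1 * x + z.2)
  linarith

/-- Integrating over intercepts gives at most the mass `1`, and the slopes range over an interval of
length `2 w`; dividing by the area `4 w ^ 2` leaves a height independent of `ρ`. -/
theorem lineAvg_le {w x ρ : ℝ} (hw : 0 < w) {g : ℝ → ℝ} (hg : Continuous g)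
    (hg0 : ∀ s, 0 ≤ g s) (hsupp : ∀ s, ρ < |s| → g s = 0) (hg1 : ∫ s, g s = 1) (s : ℝ) :
    lineAvg w x g s ≤ (2 * w)⁻¹ := by
  have hint : Integrable g := integrable_of_abs_le hg hsupp
  have hinner : ∀ a, ∫ b in closedBall (0 : ℝ) w, g (s - (a * x + b)) ≤ 1 := fun a => by
    have e : ∀ b, s - (a * x + b) = (s - a * x) - b := fun b => by ring
    simp only [e]
    rw [← hg1, ← integral_sub_left_eq_self g volume (s - a * x)]
    exact setIntegral_le_integral (hint.comp_sub_left _) (Filter.Eventually.of_forall fun _ => hg0 _)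
  have hprod : ∫ z in closedBall (0 : ℝ × ℝ) w, g (s - (z.1 * x + z.2)) ≤ 2 * w := by
    rw [show (0 : ℝ × ℝ) = (0, 0) from rfl, ← closedBall_prod_same, Measure.volume_eq_prod,
      setIntegral_prod]
    · refine (Real.le_norm_self _).trans ((norm_setIntegral_le_of_norm_le_const (C := 1)
        (isCompact_closedBall _ _).measure_lt_top fun a _ => ?_).trans ?_)
      · rw [Real.norm_of_nonneg (integral_nonneg fun _ => hg0 _)]
        exact hinner a
      · rw [Real.closedBall_eq_Icc, Real.volume_real_Icc_of_le (by linarith)]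
        linarith
    · refine ContinuousOn.integrableOn_compact
        ((isCompact_closedBall _ _).prod (isCompact_closedBall _ _)) ?_
      exact Continuous.continuousOn (by fun_prop)
  calc lineAvg w x g s ≤ (4 * w ^ 2)⁻¹ * (2 * w) := by
        unfold lineAvg
        gcongr
    _ = (2 * w)⁻¹ := by field_simp; norm_num

theorem integral_lineAvg {w x ρ : ℝ} (hw : 0 < w) (hx : |x| ≤ 1) {g : ℝ → ℝ} (hg : Continuous g)
    (hsupp : ∀ s, ρ < |s| → g s = 0) : ∫ s, lineAvg w x g s = ∫ s, g s := by
  unfold lineAvg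
  rw [integral_const_mul, integral_integral_swap]
  · simp only [integral_sub_right_eq_self g]
    rw [setIntegral_const, volume_real_box _ hw.le, smul_eq_mul, ← mul_assoc,
      inv_mul_cancel₀ (by positivity), one_mul]
  · have h1 : IntegrableOn (Function.uncurry fun (s : ℝ) (z : ℝ × ℝ) => g (s - (z.1 * x + z.2)))
        (Icc (-(ρ + 2 * w)) (ρ + 2 * w) ×ˢ closedBall (0 : ℝ × ℝ) w) (volume.prod volume) := by
      refine ContinuousOn.integrableOn_compact (isCompact_Icc.prod (isCompact_closedBall _ _)) ?_
      exact Continuous.continuousOn (by simp only [Function.uncurry_def]; fun_prop)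
    have h2 : IntegrableOn (Function.uncurry fun (s : ℝ) (z : ℝ × ℝ) => g (s - (z.1 * x + z.2)))
        (univ ×ˢ closedBall (0 : ℝ × ℝ) w) (volume.prod volume) := by
      refine h1.of_forall_sdiff_eq_zero
        (MeasurableSet.univ.prod measurableSet_closedBall) fun p hp => ?_
      refine hsupp _ ?_
      have h3 := abs_mul_add_le_of_mem_box hx hp.1.2
      have h4 := abs_sub_abs_le_abs_sub p.1 (p.2.1 * x + p.2.2)
      have h5 : ρ + 2 * w < |p.1| := by
        by_contra h
        exact hp.2 ⟨abs_le.1 (not_lt.1 h), hp.1.2⟩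
      linarith
    rwa [IntegrableOn, ← Measure.prod_restrict, Measure.restrict_univ] at h2

/-- Both averages keep mass `1`, so their difference has mean zero. Height and, once `ρ` is
comparable to `w`, width depend only on the scale `w`. -/
theorem isProfile_lineAvg_sub {w x ρ : ℝ} (hw : 0 < w) (hx : |x| ≤ 1) {g : ℝ → ℝ}
    (hg : Continuous g) (hg0 : ∀ s, 0 ≤ g s) (hsupp : ∀ s, ρ < |s| → g s = 0)
    (hg1 : ∫ s, g s = 1) :
    IsProfile (ρ + 4 * w) w⁻¹ (fun s => lineAvg w x g s - lineAvg (2 * w) x g s) := by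
  have hc1 := continuous_lineAvg w x hg
  have hc2 := continuous_lineAvg (2 * w) x hg
  have hs1 : ∀ s, ρ + 4 * w < |s| → lineAvg w x g s = 0 := fun s hs =>
    lineAvg_eq_zero hx hsupp (by linarith)
  have hs2 : ∀ s, ρ + 4 * w < |s| → lineAvg (2 * w) x g s = 0 := fun s hs =>
    lineAvg_eq_zero hx hsupp (by linarith)
  have hi1 := integrable_of_abs_le hc1 hs1
  have hi2 := integrable_of_abs_le hc2 hs2
  have hm1 : ∫ s, lineAvg w x g s = 1 := by rw [integral_lineAvg hw hx hg hsupp, hg1]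
  have hm2 : ∫ s, lineAvg (2 * w) x g s = 1 := by
    rw [integral_lineAvg (by positivity) hx hg hsupp, hg1]
  have hw' : (2 * w)⁻¹ ≤ w⁻¹ := inv_anti₀ hw (by linarith)
  have hw'' : (2 * (2 * w))⁻¹ ≤ w⁻¹ := inv_anti₀ hw (by linarith)
  refine ⟨hc1.sub hc2, fun s hs => by rw [hs1 s hs, hs2 s hs, sub_zero], fun s => ?_, ?_, ?_⟩
  · have a1 := lineAvg_nonneg w x hg0 s
    have a2 := lineAvg_nonneg (2 * w) x hg0 s
    have a3 := lineAvg_le (x := x) hw hg hg0 hsupp hg1 s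
    have a4 := lineAvg_le (w := 2 * w) (x := x) (by positivity) hg hg0 hsupp hg1 s
    exact abs_le.2 ⟨by linarith, by linarith⟩
  · rw [integral_sub hi1 hi2, hm1, hm2, sub_self]
  · calc ∫ s, |lineAvg w x g s - lineAvg (2 * w) x g s|
        ≤ ∫ s, (lineAvg w x g s + lineAvg (2 * w) x g s) := by
          refine integral_mono (hi1.sub hi2).abs (hi1.add hi2) fun s => ?_
          have a1 := lineAvg_nonneg w x hg0 s
          have a2 := lineAvg_nonneg (2 * w) x hg0 s
          exact abs_le.2 ⟨by linarith, by linarith⟩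
      _ = 2 := by rw [integral_add hi1 hi2, hm1, hm2]; norm_num
      _ ≤ 2 := le_rfl

/-- The tent function of height `1 / ρ` and support `[-ρ, ρ]`. -/
def tent (ρ s : ℝ) : ℝ := ρ⁻¹ * max 0 (1 - |s| / ρ)

theorem continuous_tent (ρ : ℝ) : Continuous (tent ρ) := by
  unfold tent
  fun_prop

theorem tent_nonneg {ρ : ℝ} (hρ : 0 < ρ) (s : ℝ) : 0 ≤ tent ρ s :=
  mul_nonneg (inv_nonneg.2 hρ.le) (le_max_left _ _)

theorem tent_eq_zero {ρ : ℝ} (hρ : 0 < ρ) (s : ℝ) (hs : ρ < |s|) : tent ρ s = 0 := by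
  unfold tent
  rw [max_eq_left, mul_zero]
  rw [sub_nonpos, le_div_iff₀ hρ]
  linarith

theorem le_tent {ρ s : ℝ} (hρ : 0 < ρ) (hs : |s| ≤ 3 / 4 * ρ) : (4 * ρ)⁻¹ ≤ tent ρ s := by
  have h1 : |s| / ρ ≤ 3 / 4 := by rwa [div_le_iff₀ hρ]
  have h2 : 1 / 4 ≤ max 0 (1 - |s| / ρ) := le_max_of_le_right (by linarith)
  calc (4 * ρ)⁻¹ = ρ⁻¹ * (1 / 4) := by rw [mul_inv]; ring
    _ ≤ tent ρ s := by unfold tent; gcongr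

theorem integral_tent {ρ : ℝ} (hρ : 0 < ρ) : ∫ s, tent ρ s = 1 := by
  have h1 : ∫ s, tent ρ s = ∫ s, tent ρ |s| := by
    congr 1; funext s; simp [tent]
  have h2 : ∫ s in Ioi (0 : ℝ), tent ρ s = ∫ s in Ioc 0 ρ, tent ρ s := by
    refine (setIntegral_eq_of_subset_of_forall_sdiff_eq_zero measurableSet_Ioi
      (fun s hs => hs.1) fun s hs => ?_)
    refine tent_eq_zero hρ s ?_
    have : ρ < s := by
      by_contra h
      exact hs.2 ⟨hs.1, not_lt.1 h⟩
    exact this.trans_le (le_abs_self s)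
  have h3 : ∫ s in (0 : ℝ)..ρ, tent ρ s = ∫ s in (0 : ℝ)..ρ, (ρ⁻¹ - ρ⁻¹ ^ 2 * s) := by
    refine intervalIntegral.integral_congr fun s hs => ?_
    rw [uIcc_of_le hρ.le] at hs
    have : s / ρ ≤ 1 := (div_le_one hρ).2 hs.2
    simp only [tent]
    rw [abs_of_nonneg hs.1, max_eq_right (by linarith)]
    field_simp
  rw [h1, integral_comp_abs, h2, ← intervalIntegral.integral_of_le hρ.le, h3,
    intervalIntegral.integral_sub (by simp) (by
      exact (Continuous.intervalIntegrable (by fun_prop) _ _)),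
    intervalIntegral.integral_const_mul, integral_id, intervalIntegral.integral_const]
  simp only [smul_eq_mul]
  field_simp
  ring

/-! ### Dyadic cells -/

/-- The index of the dyadic cell of level `j` which contains the point `(x, y)`. -/
def dyadicCell (j : ℕ) (x y : ℝ) : ℤ × ℤ := (⌊2 ^ j * x⌋, ⌊2 ^ j * y⌋)

theorem floor_two_pow_mul {l j : ℕ} (h : l ≤ j) (x : ℝ) :
    ⌊2 ^ l * x⌋ = ⌊2 ^ j * x⌋ / ((2 ^ (j - l) : ℕ) : ℤ) := by
  rw [← Int.floor_div_natCast]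
  congr 1
  push_cast
  rw [eq_div_iff (by positivity)]
  calc 2 ^ l * x * 2 ^ (j - l) = 2 ^ (l + (j - l)) * x := by rw [pow_add]; ring
    _ = 2 ^ j * x := by rw [Nat.add_sub_cancel' h]

theorem dyadicCell_eq_of_le {l j : ℕ} (h : l ≤ j) {x y x' y' : ℝ}
    (hc : dyadicCell j x y = dyadicCell j x' y') : dyadicCell l x y = dyadicCell l x' y' := by
  simp only [dyadicCell, Prod.mk.injEq] at hc ⊢
  rw [floor_two_pow_mul h x, floor_two_pow_mul h y, floor_two_pow_mul h x', floor_two_pow_mul h y',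
    hc.1, hc.2]
  exact ⟨rfl, rfl⟩

theorem abs_sub_le_of_floor_eq {j : ℕ} {x x' : ℝ} (h : ⌊2 ^ j * x⌋ = ⌊2 ^ j * x'⌋) :
    |x - x'| ≤ (2 ^ j)⁻¹ := by
  have h1 := (Int.abs_sub_lt_one_of_floor_eq_floor h).le
  rw [← mul_sub, abs_mul, abs_of_pos (by positivity : (0 : ℝ) < 2 ^ j)] at h1
  rwa [← one_div, le_div_iff₀' (by positivity)]

theorem floor_mem_Icc_of_abs_sub_le {l : ℕ} {x x' : ℝ} (h : |x - x'| ≤ (2 ^ l)⁻¹) :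
    ⌊2 ^ l * x'⌋ ∈ Finset.Icc (⌊2 ^ l * x⌋ - 1) (⌊2 ^ l * x⌋ + 1) := by
  have h1 : |2 ^ l * x - 2 ^ l * x'| ≤ 1 := by
    rw [← mul_sub, abs_mul, abs_of_pos (by positivity : (0 : ℝ) < 2 ^ l)]
    calc (2 : ℝ) ^ l * |x - x'| ≤ 2 ^ l * (2 ^ l)⁻¹ := by gcongr
      _ = 1 := mul_inv_cancel₀ (by positivity)
  rw [abs_le] at h1
  rw [Finset.mem_Icc]
  constructor
  · rw [Int.le_floor]
    push_cast
    linarith [Int.floor_le (2 ^ l * x)]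
  · rw [Int.floor_le_iff]
    push_cast
    linarith [Int.lt_floor_add_one (2 ^ l * x)]

/-- A square of side `2 · 2⁻ˡ` meets at most nine cells of level `l`. -/
theorem card_near_le {κ : Type*} (Z : Finset κ) (X Y : κ → ℝ) (l : ℕ) {N : ℝ} (x y : ℝ)
    (hN : ∀ k, ((Z.filter (fun z => dyadicCell l (X z) (Y z) = k)).card : ℝ) ≤ N) :
    ((Z.filter (fun z => |x - X z| ≤ (2 ^ l)⁻¹ ∧ |y - Y z| ≤ (2 ^ l)⁻¹)).card : ℝ) ≤ 9 * N := by
  set I := Finset.Icc (⌊2 ^ l * x⌋ - 1) (⌊2 ^ l * x⌋ + 1) ×ˢ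
    Finset.Icc (⌊2 ^ l * y⌋ - 1) (⌊2 ^ l * y⌋ + 1) with hI
  have hsub : Z.filter (fun z => |x - X z| ≤ (2 ^ l)⁻¹ ∧ |y - Y z| ≤ (2 ^ l)⁻¹) ⊆
      I.biUnion (fun k => Z.filter (fun z => dyadicCell l (X z) (Y z) = k)) := by
    intro z hz
    rw [Finset.mem_filter] at hz
    rw [Finset.mem_biUnion]
    refine ⟨dyadicCell l (X z) (Y z), ?_, by simp [hz.1]⟩
    rw [hI, Finset.mem_product]
    exact ⟨floor_mem_Icc_of_abs_sub_le hz.2.1, floor_mem_Icc_of_abs_sub_le hz.2.2⟩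
  have hcard : I.card = 9 := by
    rw [hI, Finset.card_product, Int.card_Icc, Int.card_Icc]
    have : ∀ k : ℤ, k + 1 + 1 - (k - 1) = 3 := fun k => by ring
    rw [this, this]
    rfl
  calc _ ≤ ((I.biUnion (fun k => Z.filter (fun z => dyadicCell l (X z) (Y z) = k))).card : ℝ) := by
        exact_mod_cast Finset.card_le_card hsub
    _ ≤ ∑ k ∈ I, ((Z.filter (fun z => dyadicCell l (X z) (Y z) = k)).card : ℝ) := by
        exact_mod_cast Finset.card_biUnion_le
    _ ≤ ∑ _k ∈ I, N := Finset.sum_le_sum fun k _ => hN k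
    _ = 9 * N := by rw [Finset.sum_const, hcard, nsmul_eq_mul]; norm_num

/-! ### The energy of a Frostman set at a given scale -/

/-- A single term, at the finest `l ≤ i` for which both coordinates agree up to `2⁻ˡ`, already
dominates the kernel. Bounding by the sum over all `l` allows exchanging summations, which turns an
energy into counts of points in squares. -/
theorem abs_kernel_le_sum {i : ℕ} {w L : ℝ} (hw : w = (2 ^ i)⁻¹) (hL0 : 0 < L) (hL : L ≤ 260 * w)
    {ψ₁ ψ₂ : ℝ → ℝ}
    (h₁ : IsProfile L w⁻¹ ψ₁) (h₂ : IsProfile L w⁻¹ ψ₂) {x₁ y₁ x₂ y₂ : ℝ}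
    (hx : |x₁ - x₂| ≤ 1) (hy : |y₁ - y₂| ≤ 1) :
    |kernel ψ₁ ψ₂ x₁ y₁ x₂ y₂| ≤ ∑ l ∈ Finset.range (i + 1),
      if |x₁ - x₂| ≤ (2 ^ l)⁻¹ ∧ |y₁ - y₂| ≤ (2 ^ l)⁻¹ then 2 ^ 27 * w⁻¹ * (4 ^ l / 4 ^ i)
      else 0 := by
  have hw0 : 0 < w := by rw [hw]; positivity
  set p : ℕ → Prop := fun l => |x₁ - x₂| ≤ (2 ^ l)⁻¹ ∧ |y₁ - y₂| ≤ (2 ^ l)⁻¹ with hp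
  have hp0 : p 0 := by simpa [hp] using ⟨hx, hy⟩
  set l := Nat.findGreatest p i with hl
  have hli : l ≤ i := Nat.findGreatest_le i
  have hpl : p l := Nat.findGreatest_spec (Nat.zero_le i) hp0
  have hterm : (if p l then 2 ^ 27 * w⁻¹ * (4 ^ l / 4 ^ i) else 0) ≤
      ∑ l ∈ Finset.range (i + 1), if p l then 2 ^ 27 * w⁻¹ * (4 ^ l / 4 ^ i) else 0 :=
    Finset.single_le_sum (f := fun l => if p l then 2 ^ 27 * w⁻¹ * (4 ^ l / 4 ^ i) else (0 : ℝ))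
      (fun l _ => by split_ifs <;> positivity) (Finset.mem_range.2 (by omega))
  refine le_trans ?_ hterm
  rw [if_pos hpl]
  rcases hli.eq_or_lt with h | h
  · refine (abs_kernel_le h₁ h₂ _ _ _ _).trans ?_
    rw [h, div_self (by positivity), mul_one]
    gcongr
    norm_num
  · have hnot : ¬ p (l + 1) := Nat.findGreatest_is_greatest (Nat.lt_succ_self l) h
    have hd : (2 ^ (l + 1) : ℝ)⁻¹ ≤ |x₁ - x₂| ∨ (2 ^ (l + 1) : ℝ)⁻¹ ≤ |y₁ - y₂| := by
      by_contra hcon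
      rw [not_or, not_le, not_le] at hcon
      exact hnot ⟨hcon.1.le, hcon.2.le⟩
    refine (abs_kernel_le_of_dist hL0 (by positivity) h₁ h₂ hd).trans ?_
    have e1 : (2 ^ (l + 1) : ℝ)⁻¹ ^ 2 = (4 * 4 ^ l)⁻¹ := by
      rw [inv_pow, ← pow_mul, mul_comm (l + 1) 2, pow_mul, pow_succ]
      norm_num
      ring
    have e2 : w⁻¹ * (1 / 4 ^ i) = w := by
      have : (4 : ℝ) ^ i = (2 ^ i) ^ 2 := by rw [← pow_mul, mul_comm, pow_mul]; norm_num
      rw [this, hw]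
      field_simp
    have e3 : L + L ^ 2 * w⁻¹ ≤ 67860 * w := by
      have : L ^ 2 * w⁻¹ ≤ (260 * w) ^ 2 * w⁻¹ := by gcongr
      have e : (260 * w) ^ 2 * w⁻¹ = 67600 * w := by field_simp; norm_num
      linarith
    rw [e1, div_inv_eq_mul]
    calc 256 * (L + L ^ 2 * w⁻¹) * (4 * 4 ^ l) ≤ 256 * (67860 * w) * (4 * 4 ^ l) := by gcongr
      _ ≤ 2 ^ 27 * w * 4 ^ l := by
          have : 0 ≤ w * (4 : ℝ) ^ l := by positivity
          nlinarith
      _ = 2 ^ 27 * (w⁻¹ * (1 / 4 ^ i)) * 4 ^ l := by rw [e2]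
      _ = _ := by ring

/-- The count at distance `2⁻ˡ` grows like `2 ^ ((j - l) m)` and the kernel decays like `4 ^ (l -
i)`. As `m ≤ 2`, the product is largest at `l = i`, so every scale costs at most as much as the
finest. -/
theorem sum_abs_kernel_le {κ : Type*} (Z : Finset κ) (X Y : κ → ℝ)
    (hX : ∀ z ∈ Z, X z ∈ Icc (0 : ℝ) 1) (hY : ∀ z ∈ Z, Y z ∈ Icc (0 : ℝ) 1)
    {i j : ℕ} (hij : i ≤ j) {A m : ℝ} (hA : 0 ≤ A) (hm : m ≤ 2)
    (hZ : ∀ l ≤ j, ∀ k, ((Z.filter (fun z => dyadicCell l (X z) (Y z) = k)).card : ℝ)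
      ≤ A * 2 ^ (((j : ℝ) - l) * m))
    {w L : ℝ} (hw : w = (2 ^ i)⁻¹) (hL0 : 0 < L) (hL : L ≤ 260 * w) {ψ : κ → ℝ → ℝ}
    (hψ : ∀ z ∈ Z, IsProfile L w⁻¹ (ψ z)) {q : κ} (hq : q ∈ Z) :
    ∑ z ∈ Z, |kernel (ψ q) (ψ z) (X q) (Y q) (X z) (Y z)|
      ≤ (j + 1) * (2 ^ 31 * A * w⁻¹ * 2 ^ (((j : ℝ) - i) * m)) := by
  have hw0 : 0 < w := by rw [hw]; positivity
  have hdist : ∀ {a b : ℝ}, a ∈ Icc (0 : ℝ) 1 → b ∈ Icc (0 : ℝ) 1 → |a - b| ≤ 1 :=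
    fun {a b} ha hb => abs_le.2 ⟨by linarith [ha.1, hb.2], by linarith [ha.2, hb.1]⟩
  calc ∑ z ∈ Z, |kernel (ψ q) (ψ z) (X q) (Y q) (X z) (Y z)|
      ≤ ∑ z ∈ Z, ∑ l ∈ Finset.range (i + 1),
          if |X q - X z| ≤ (2 ^ l)⁻¹ ∧ |Y q - Y z| ≤ (2 ^ l)⁻¹
          then 2 ^ 27 * w⁻¹ * (4 ^ l / 4 ^ i) else 0 :=
        Finset.sum_le_sum fun z hz => abs_kernel_le_sum hw hL0 hL (hψ q hq) (hψ z hz)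
          (hdist (hX q hq) (hX z hz)) (hdist (hY q hq) (hY z hz))
    _ = ∑ l ∈ Finset.range (i + 1),
          ((Z.filter (fun z => |X q - X z| ≤ (2 ^ l)⁻¹ ∧ |Y q - Y z| ≤ (2 ^ l)⁻¹)).card : ℝ) *
            (2 ^ 27 * w⁻¹ * (4 ^ l / 4 ^ i)) := by
        rw [Finset.sum_comm]
        refine Finset.sum_congr rfl fun l _ => ?_
        rw [← Finset.sum_filter, Finset.sum_const, nsmul_eq_mul]
    _ ≤ ∑ _l ∈ Finset.range (i + 1), 2 ^ 31 * A * w⁻¹ * 2 ^ (((j : ℝ) - i) * m) := by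
        refine Finset.sum_le_sum fun l hl => ?_
        have hli : l ≤ i := by rw [Finset.mem_range] at hl; omega
        have hc := card_near_le Z X Y l (X q) (Y q) (hZ l (hli.trans hij))
        have hli' : (l : ℝ) ≤ i := by exact_mod_cast hli
        have e1 : (4 : ℝ) ^ l / 4 ^ i = 2 ^ (2 * ((l : ℝ) - i)) := by
          rw [Real.rpow_mul (by norm_num), Real.rpow_sub (by norm_num)]
          norm_num
        have e2 : (2 : ℝ) ^ (((j : ℝ) - l) * m) * (4 ^ l / 4 ^ i) ≤ 2 ^ (((j : ℝ) - i) * m) := by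
          rw [e1, ← Real.rpow_add (by norm_num)]
          refine Real.rpow_le_rpow_of_exponent_le (by norm_num) ?_
          nlinarith
        calc _ ≤ 9 * (A * 2 ^ (((j : ℝ) - l) * m)) * (2 ^ 27 * w⁻¹ * (4 ^ l / 4 ^ i)) := by gcongr
          _ = 9 * 2 ^ 27 * A * w⁻¹ * (2 ^ (((j : ℝ) - l) * m) * (4 ^ l / 4 ^ i)) := by ring
          _ ≤ 9 * 2 ^ 27 * A * w⁻¹ * 2 ^ (((j : ℝ) - i) * m) := by gcongr
          _ ≤ _ := by gcongr; norm_num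
    _ = (i + 1) * (2 ^ 31 * A * w⁻¹ * 2 ^ (((j : ℝ) - i) * m)) := by
        rw [Finset.sum_const, Finset.card_range, nsmul_eq_mul]; push_cast; ring
    _ ≤ _ := by
        have : (i : ℝ) ≤ j := by exact_mod_cast hij
        gcongr

theorem energy_expand {κ : Type*} (Z : Finset κ) (X Y : κ → ℝ) {L M : ℝ} {ψ : κ → ℝ → ℝ}
    (hψ : ∀ z ∈ Z, IsProfile L M (ψ z)) :
    Integrable (fun t : ℝ × ℝ =>
        slopeCutoff t.1 * (∑ z ∈ Z, ψ z (Y z - t.1 * X z - t.2)) ^ 2) ∧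
      ∫ t : ℝ × ℝ, slopeCutoff t.1 * (∑ z ∈ Z, ψ z (Y z - t.1 * X z - t.2)) ^ 2
        = ∑ q ∈ Z, ∑ z ∈ Z, kernel (ψ q) (ψ z) (X q) (Y q) (X z) (Y z) := by
  have e : (fun t : ℝ × ℝ => slopeCutoff t.1 * (∑ z ∈ Z, ψ z (Y z - t.1 * X z - t.2)) ^ 2)
      = fun t : ℝ × ℝ => ∑ q ∈ Z, ∑ z ∈ Z, slopeCutoff t.1 *
        (ψ q (Y q - t.1 * X q - t.2) * ψ z (Y z - t.1 * X z - t.2)) := by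
    funext t
    rw [sq, Finset.sum_mul_sum, Finset.mul_sum]
    exact Finset.sum_congr rfl fun q _ => by rw [Finset.mul_sum]
  have hint : ∀ q ∈ Z, ∀ z ∈ Z, Integrable fun t : ℝ × ℝ => slopeCutoff t.1 *
        (ψ q (Y q - t.1 * X q - t.2) * ψ z (Y z - t.1 * X z - t.2)) := fun q hq z hz =>
    integrable_kernel (hψ q hq) (hψ z hz) _ _ _ _
  rw [e]
  refine ⟨integrable_finsetSum _ fun q hq => integrable_finsetSum _ fun z hz => hint q hq z hz, ?_⟩
  rw [integral_finsetSum _ fun q hq => integrable_finsetSum _ fun z hz => hint q hq z hz]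
  refine Finset.sum_congr rfl fun q hq => ?_
  rw [integral_finsetSum _ fun z hz => hint q hq z hz]
  rfl

theorem sum_le_of_sum_sq_le {ι : Type*} (T : Finset ι) (f : ι → ℝ) {B E : ℝ} (hE : 0 ≤ E)
    (hB : ∑ t ∈ T, f t ^ 2 ≤ B) (hBE : (T.card : ℝ) * B ≤ E ^ 2) : ∑ t ∈ T, f t ≤ E := by
  have h1 : (∑ t ∈ T, f t) ^ 2 ≤ E ^ 2 :=
    (sq_sum_le_card_mul_sum_sq (s := T) (f := f)).trans
      ((mul_le_mul_of_nonneg_left hB (Nat.cast_nonneg _)).trans hBE)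
  exact abs_le_of_sq_le_sq' h1 hE |>.2

/-! ### The incidence estimate -/

/-- An incidence estimate between a set `Z` of points which satisfies a Frostman condition of
dimension `m`, and a set of lines of which at most `N i` lie in a square of side `4 · 2⁻ⁱ`. -/
theorem incidence_le {ι κ : Type*} (T : Finset ι) (ℓ : ι → ℝ × ℝ) (hℓ : ∀ t ∈ T, |(ℓ t).1| ≤ 1)
    (Z : Finset κ) (X Y : κ → ℝ)
    (hX : ∀ z ∈ Z, X z ∈ Icc (0 : ℝ) 1) (hY : ∀ z ∈ Z, Y z ∈ Icc (0 : ℝ) 1)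
    (j : ℕ) {A m : ℝ} (hA : 0 ≤ A) (hm : m ≤ 2)
    (hZ : ∀ l ≤ j, ∀ k, ((Z.filter (fun z => dyadicCell l (X z) (Y z) = k)).card : ℝ)
      ≤ A * 2 ^ (((j : ℝ) - l) * m))
    (N : ℕ → ℝ) (hN : ∀ i ≤ j, ∀ z : ℝ × ℝ,
      ((T.filter (fun t => z ∈ closedBall (ℓ t) (2 * (2 ^ i)⁻¹))).card : ℝ) ≤ N i)
    {E : ℝ} (hE : 0 ≤ E)
    (hNE : ∀ i ≤ j, (T.card : ℝ) * ((2 ^ i) ^ 2 * N i *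
      ((Z.card : ℝ) * ((j + 1) * (2 ^ 31 * A * 2 ^ i * 2 ^ (((j : ℝ) - i) * m))))) ≤ E ^ 2) :
    ∑ z ∈ Z, ((T.filter (fun t => |Y z - (ℓ t).1 * X z - (ℓ t).2| ≤ 132 * (2 ^ j)⁻¹)).card : ℝ)
      ≤ 1024 * (2 ^ j)⁻¹ * ((T.card : ℝ) * (Z.card : ℝ) + 2 * j * E) := by
  set r : ℝ := (2 ^ j)⁻¹ with hr
  have hr0 : 0 < r := by rw [hr]; positivity
  -- The width leaves room for two averages at scale `r`: each shifts the vertical distance by at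
  -- most `2 r`, and `132 r + 4 r` is below three quarters of `256 r`, where `le_tent` gives `(1024
  -- r)⁻¹`.
  set g : ℝ → ℝ := tent (256 * r) with hg
  have hgc : Continuous g := continuous_tent _
  have hg0 : ∀ s, 0 ≤ g s := tent_nonneg (by positivity)
  have hgs : ∀ s, 256 * r < |s| → g s = 0 := tent_eq_zero (by positivity)
  have hg1 : ∫ s, g s = 1 := integral_tent (by positivity)
  set Fq : κ → ℝ × ℝ → ℝ := fun z t => g (Y z - t.1 * X z - t.2) with hFq
  have hFqc : ∀ z, Continuous (Fq z) := fun z => by simp only [hFq]; fun_prop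
  set F : ℝ × ℝ → ℝ := fun t => ∑ z ∈ Z, Fq z t with hF
  have hFc : Continuous F := continuous_finsetSum _ fun z _ => hFqc z
  have hxabs : ∀ z ∈ Z, |X z| ≤ 1 := fun z hz =>
    abs_le.2 ⟨by linarith [(hX z hz).1], (hX z hz).2⟩
  set U : ℕ → ℝ × ℝ → ℝ := fun i => boxAvg (2 ^ i)⁻¹ (boxAvg (2 ^ i)⁻¹ F) with hU
  have havg : ∀ w, boxAvg w F = fun t => ∑ z ∈ Z, lineAvg w (X z) g (Y z - t.1 * X z - t.2) := by
    intro w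
    rw [hF, boxAvg_sum w Z hFqc]
    funext t
    exact Finset.sum_congr rfl fun z _ => by rw [hFq, boxAvg_comp]
  -- the coarsest scale
  have hU0 : ∀ t, U 0 t ≤ Z.card := by
    intro t
    simp only [hU, pow_zero, inv_one]
    rw [← boxAvg_const one_pos (Z.card : ℝ) t]
    refine boxAvg_mono (continuous_boxAvg _ hFc) continuous_const t fun z _ => ?_
    rw [havg]
    calc ∑ q ∈ Z, lineAvg 1 (X q) g (Y q - z.1 * X q - z.2) ≤ ∑ _q ∈ Z, (1 : ℝ) :=
          Finset.sum_le_sum fun q _ =>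
            (lineAvg_le one_pos hgc hg0 hgs hg1 _).trans (by norm_num)
      _ = Z.card := by simp
  -- passing from one scale to the next
  have hstep : ∀ i, i + 1 ≤ j → ∑ t ∈ T, U (i + 1) (ℓ t) ≤ ∑ t ∈ T, U i (ℓ t) + 2 * E := by
    intro i hij
    set w : ℝ := (2 ^ (i + 1))⁻¹ with hw
    have hw0 : 0 < w := by rw [hw]; positivity
    have h2w : (2 ^ i : ℝ)⁻¹ = 2 * w := by
      rw [hw, pow_succ, mul_inv]; ring
    have h2w1 : 2 * w ≤ 1 := by
      rw [← h2w]; exact inv_le_one_of_one_le₀ (one_le_pow₀ (by norm_num))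
    have hrw : r ≤ w := by
      rw [hr, hw]; exact inv_anti₀ (by positivity) (pow_le_pow_right₀ (by norm_num) hij)
    set H : ℝ × ℝ → ℝ := fun t => boxAvg w F t - boxAvg (2 * w) F t with hH
    have hHc : Continuous H := (continuous_boxAvg _ hFc).sub (continuous_boxAvg _ hFc)
    -- With `A_w` the average at scale `w`, this is `A_w² - A_{2w}² = (A_w + A_{2w}) (A_w -
    -- A_{2w})`. The inner difference produces profiles of mean zero; the outer average lets values
    -- at single lines be bounded by local `L²` norms.
    have htel : ∀ t, U (i + 1) t - U i t = boxAvg w H t + boxAvg (2 * w) H t := by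
      intro t
      simp only [hU, hH, h2w, ← hw]
      rw [boxAvg_sub _ (continuous_boxAvg _ hFc) (continuous_boxAvg _ hFc),
        boxAvg_sub _ (continuous_boxAvg _ hFc) (continuous_boxAvg _ hFc),
        boxAvg_comm w (2 * w) hFc]
      ring
    set ψ : κ → ℝ → ℝ := fun z s => lineAvg w (X z) g s - lineAvg (2 * w) (X z) g s with hψd
    have hψ : ∀ z ∈ Z, IsProfile (256 * r + 4 * w) w⁻¹ (ψ z) := fun z hz =>
      isProfile_lineAvg_sub hw0 (hxabs z hz) hgc hg0 hgs hg1
    have hHψ : H = fun t => ∑ z ∈ Z, ψ z (Y z - t.1 * X z - t.2) := by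
      funext t
      simp only [hH, hψd, havg, Finset.sum_sub_distrib]
    obtain ⟨hint, hen⟩ := energy_expand Z X Y hψ
    have henergy : ∫ t : ℝ × ℝ, slopeCutoff t.1 * H t ^ 2
        ≤ (Z.card : ℝ) * ((j + 1) * (2 ^ 31 * A * w⁻¹ * 2 ^ (((j : ℝ) - (i + 1 : ℕ)) * m))) := by
      rw [hHψ]
      simp only
      rw [hen]
      calc _ ≤ ∑ q ∈ Z, ∑ z ∈ Z, |kernel (ψ q) (ψ z) (X q) (Y q) (X z) (Y z)| :=
            Finset.sum_le_sum fun q _ => Finset.sum_le_sum fun z _ => le_abs_self _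
        _ ≤ ∑ _q ∈ Z, ((j + 1) * (2 ^ 31 * A * w⁻¹ * 2 ^ (((j : ℝ) - (i + 1 : ℕ)) * m))) :=
            Finset.sum_le_sum fun q hq => sum_abs_kernel_le Z X Y hX hY hij hA hm hZ hw
              (by positivity) (by linarith) hψ hq
        _ = _ := by rw [Finset.sum_const, nsmul_eq_mul]
    have hint' : Integrable fun t : ℝ × ℝ => slopeCutoff t.1 * H t ^ 2 := by rw [hHψ]; exact hint
    have hN0 : 0 ≤ N (i + 1) := (Nat.cast_nonneg _).trans (hN (i + 1) hij 0)
    have hbd : ∀ w', w ≤ w' → w' ≤ 2 * w → ∑ t ∈ T, boxAvg w' H (ℓ t) ≤ E := by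
      intro w' h1 h2
      have hw'0 : 0 < w' := hw0.trans_le h1
      refine sum_le_of_sum_sq_le T _ hE (B := (2 ^ (i + 1)) ^ 2 * N (i + 1) *
        ((Z.card : ℝ) * ((j + 1) * (2 ^ 31 * A * 2 ^ (i + 1) *
          2 ^ (((j : ℝ) - (i + 1 : ℕ)) * m))))) ?_ (hNE (i + 1) hij)
      refine (sum_sq_boxAvg_le T ℓ hw'0 (h2.trans h2w1) hℓ (N := N (i + 1)) (fun z => ?_) hHc
        hint').trans ?_
      · refine le_trans ?_ (hN (i + 1) hij z)
        exact Nat.cast_le.2 (Finset.card_le_card (Finset.monotone_filter_right _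
          fun t _ ht => closedBall_subset_closedBall h2 ht))
      · have hwi : w⁻¹ = 2 ^ (i + 1) := by rw [hw, inv_inv]
        rw [hwi] at henergy
        have h3 : w'⁻¹ ≤ 2 ^ (i + 1) := by rw [← hwi]; exact inv_anti₀ hw0 h1
        have h0 : 0 ≤ ∫ t : ℝ × ℝ, slopeCutoff t.1 * H t ^ 2 :=
          integral_nonneg fun z => mul_nonneg (slopeCutoff_nonneg _) (sq_nonneg _)
        gcongr
    have e : ∑ t ∈ T, U (i + 1) (ℓ t) = ∑ t ∈ T, U i (ℓ t) +
        (∑ t ∈ T, boxAvg w H (ℓ t) + ∑ t ∈ T, boxAvg (2 * w) H (ℓ t)) := by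
      rw [← Finset.sum_add_distrib, ← Finset.sum_add_distrib]
      exact Finset.sum_congr rfl fun t _ => by linarith [htel (ℓ t)]
    rw [e]
    linarith [hbd w le_rfl (by linarith), hbd (2 * w) (by linarith) le_rfl]
  have hall : ∀ i ≤ j, ∑ t ∈ T, U i (ℓ t) ≤ (T.card : ℝ) * Z.card + 2 * i * E := by
    intro i
    induction i with
    | zero =>
      intro _
      calc ∑ t ∈ T, U 0 (ℓ t) ≤ ∑ _t ∈ T, (Z.card : ℝ) := Finset.sum_le_sum fun t _ => hU0 _
        _ = _ := by rw [Finset.sum_const, nsmul_eq_mul]; simp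
    | succ i ih =>
      intro hi
      have := hstep i hi
      have := ih (by omega)
      push_cast
      linarith
  -- the finest scale
  have hlow : ∀ t ∈ T, ∑ z ∈ Z, (if |Y z - (ℓ t).1 * X z - (ℓ t).2| ≤ 132 * r
      then (1024 * r)⁻¹ else 0) ≤ U j (ℓ t) := by
    intro t _
    have hUj : U j (ℓ t) = ∑ z ∈ Z, boxAvg r (boxAvg r (Fq z)) (ℓ t) := by
      simp only [hU, ← hr, hF]
      rw [boxAvg_sum r Z hFqc, boxAvg_sum r Z fun z => continuous_boxAvg r (hFqc z)]
    rw [hUj]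
    refine Finset.sum_le_sum fun z hz => ?_
    split_ifs with h
    · rw [← boxAvg_const hr0 (1024 * r)⁻¹ (ℓ t)]
      refine boxAvg_mono continuous_const (continuous_boxAvg r (hFqc z)) _ fun s hs => ?_
      rw [← boxAvg_const hr0 (1024 * r)⁻¹ s]
      refine boxAvg_mono continuous_const (hFqc z) _ fun s' hs' => ?_
      have hball : ∀ {s s' : ℝ × ℝ}, s' ∈ closedBall s r →
          |Y z - s'.1 * X z - s'.2| ≤ |Y z - s.1 * X z - s.2| + 2 * r := by
        intro s s' hs
        have h1 := abs_mul_add_le_of_mem_box (hxabs z hz) (w := r) (z := s' - s)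
          (by rwa [mem_closedBall, dist_zero_right, ← dist_eq_norm])
        have h2 : Y z - s'.1 * X z - s'.2
            = (Y z - s.1 * X z - s.2) - ((s' - s).1 * X z + (s' - s).2) := by
          simp only [Prod.fst_sub, Prod.snd_sub]; ring
        rw [h2]
        exact (abs_sub _ _).trans (by linarith)
      have h1 := hball hs
      have h2 := hball hs'
      have h3 := le_tent (ρ := 256 * r) (s := Y z - s'.1 * X z - s'.2) (by positivity) (by linarith)
      rw [show 4 * (256 * r) = 1024 * r by ring] at h3
      exact h3
    · have h0 : ∀ s, boxAvg r (fun _ => (0 : ℝ)) s = 0 := boxAvg_const hr0 0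
      rw [← h0 (ℓ t)]
      refine boxAvg_mono continuous_const (continuous_boxAvg r (hFqc z)) _ fun s _ => ?_
      rw [← h0 s]
      exact boxAvg_mono continuous_const (hFqc z) _ fun s' _ => hg0 _
  have hsum : (∑ z ∈ Z, ((T.filter (fun t => |Y z - (ℓ t).1 * X z - (ℓ t).2| ≤ 132 * r)).card : ℝ))
      * (1024 * r)⁻¹ = ∑ t ∈ T, ∑ z ∈ Z, (if |Y z - (ℓ t).1 * X z - (ℓ t).2| ≤ 132 * r
      then (1024 * r)⁻¹ else 0) := by
    rw [Finset.sum_comm, Finset.sum_mul]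
    refine Finset.sum_congr rfl fun z _ => ?_
    rw [← Finset.sum_filter, Finset.sum_const, nsmul_eq_mul]
  have hfin := (hsum.le.trans (Finset.sum_le_sum hlow)).trans (hall j le_rfl)
  rw [← div_eq_mul_inv, div_le_iff₀ (by positivity)] at hfin
  linarith

/-! ### Comparison of exponents -/

/-- The left side is monotone in `B`, so its extremes are at `B = 1` and `B = R`: the worst scale in
the energy is the coarsest or the finest. -/
theorem rpow_mul_rpow_le {B R a m : ℝ} (hB : 1 ≤ B) (hBR : B ≤ R) :
    B ^ (a - m) * R ^ m ≤ R ^ max m a := by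
  have hR : 0 < R := by linarith
  rcases le_total a m with h | h
  · rw [max_eq_left h]
    have : B ^ (a - m) ≤ 1 := Real.rpow_le_one_of_one_le_of_nonpos hB (by linarith)
    exact mul_le_of_le_one_left (by positivity) this
  · rw [max_eq_right h]
    calc B ^ (a - m) * R ^ m ≤ R ^ (a - m) * R ^ m := by
          gcongr
      _ = R ^ a := by rw [← Real.rpow_add hR]; congr 1; ring

theorem fine_low {D R u m : ℝ} (hD : 1 ≤ D) (hDR : D ≤ R) (hm : m ≤ u + 1) :
    D ^ m ≤ D ^ u * R := by
  have hD0 : 0 < D := by linarith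
  calc D ^ m ≤ D ^ (u + 1) := Real.rpow_le_rpow_of_exponent_le hD hm
    _ = D ^ u * D := Real.rpow_add_one hD0.ne' u
    _ ≤ _ := by gcongr

theorem fine_high {D R u m e : ℝ} (hD : 1 ≤ D) (hDR : D ≤ R) (he : e ≤ 2)
    (hm : m + e ≤ 2 * u + 2) : D ^ m ≤ (D ^ u) ^ 2 * R ^ (2 - e) := by
  have hD0 : 0 < D := by linarith
  calc D ^ m ≤ D ^ (u + u + (2 - e)) := Real.rpow_le_rpow_of_exponent_le hD (by linarith)
    _ = (D ^ u) ^ 2 * D ^ (2 - e) := by rw [Real.rpow_add hD0, Real.rpow_add hD0, sq]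
    _ ≤ _ := by gcongr

/-- Applied with `R = 2 ^ j`, `R * s = D` and `Q = 2 ^ (n - j)`, for levels above the finest. The
finest level uses `fine_low` and `fine_high`. -/
theorem coarse_low {s Q R u m : ℝ} (hs : 0 < s) (hsQ : s ≤ Q) (hR : 1 ≤ R) (hu : u ≤ 1)
    (hm0 : 0 ≤ m) (hm : m ≤ u + 1) :
    (R * s) ^ m * (128 * s) ^ u ≤ 128 * Q ^ m * (R * s) ^ u * R := by
  have hR0 : 0 < R := by linarith
  have h128 : (128 : ℝ) ^ u ≤ 128 := by
    calc (128 : ℝ) ^ u ≤ 128 ^ (1 : ℝ) := Real.rpow_le_rpow_of_exponent_le (by norm_num) hu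
      _ = 128 := Real.rpow_one _
  have hRm : R ^ m ≤ R ^ u * R := by
    rw [← Real.rpow_add_one hR0.ne']
    exact Real.rpow_le_rpow_of_exponent_le hR hm
  have hQ0 : 0 < Q := hs.trans_le hsQ
  have hsm : s ^ m ≤ Q ^ m := Real.rpow_le_rpow hs.le hsQ hm0
  rw [Real.mul_rpow hR0.le hs.le, Real.mul_rpow (by norm_num) hs.le, Real.mul_rpow hR0.le hs.le]
  calc R ^ m * s ^ m * (128 ^ u * s ^ u) ≤ (R ^ u * R) * Q ^ m * (128 * s ^ u) := by gcongr
    _ = _ := by ring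

theorem coarse_high {s Q R u m e : ℝ} (hs : 0 < s) (hsQ : s ≤ Q) (hR : 1 ≤ R) (hu : u ≤ 1)
    (hm0 : 0 ≤ m) (hm : m + e ≤ 2 * u + 2) :
    (R * s) ^ m * ((128 * s) ^ u) ^ 2 ≤ 2 ^ 14 * Q ^ m * ((R * s) ^ u) ^ 2 * R ^ (2 - e) := by
  have hR0 : 0 < R := by linarith
  have h128 : (128 : ℝ) ^ u ≤ 128 := by
    calc (128 : ℝ) ^ u ≤ 128 ^ (1 : ℝ) := Real.rpow_le_rpow_of_exponent_le (by norm_num) hu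
      _ = 128 := Real.rpow_one _
  have hRm : R ^ m ≤ (R ^ u) ^ 2 * R ^ (2 - e) := by
    rw [sq, ← Real.rpow_add hR0, ← Real.rpow_add hR0]
    exact Real.rpow_le_rpow_of_exponent_le hR (by linarith)
  have hQ0 : 0 < Q := hs.trans_le hsQ
  have hsm : s ^ m ≤ Q ^ m := Real.rpow_le_rpow hs.le hsQ hm0
  rw [Real.mul_rpow hR0.le hs.le, Real.mul_rpow (by norm_num) hs.le, Real.mul_rpow hR0.le hs.le]
  calc R ^ m * s ^ m * (128 ^ u * s ^ u) ^ 2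
      ≤ ((R ^ u) ^ 2 * R ^ (2 - e)) * Q ^ m * (128 * s ^ u) ^ 2 := by gcongr
    _ = _ := by ring

/-- The lower bound for the number of points which the incidence estimate gives at one scale. -/
theorem card_ge_of_incidence {c D u v m e Ku Kv M A φ τ ζ I E R p : ℝ} {n j : ℕ}
    (hc : 0 < c) (hD : 1 ≤ D) (hKu : 1 ≤ Ku) (hKv : 1 ≤ Kv) (hM : 0 < M) (hA : 0 < A)
    (hφ : 0 < φ) (hζ : 0 ≤ ζ) (hR : 1 ≤ R) (hjn : j ≤ n) (hE0 : 0 ≤ E)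
    (hτ : c * D ^ v ≤ τ)
    (hI : τ * (c * (Ku⁻¹ * D ^ u)) ≤ (n + 1) * (M * I))
    (hinc : I ≤ 1024 * R⁻¹ * (τ * ζ + 2 * j * E))
    (hE : E ^ 2 = τ * ζ * ((n + 1) * (2 ^ 47 * Kv * A * D ^ v * R ^ e)))
    (hlow : D ^ m * M ≤ 128 * φ * D ^ u * R)
    (hhigh : D ^ m * (M ^ 2 * A) ≤ 2 ^ 14 * Ku * φ * (D ^ u) ^ 2 * R ^ (2 - e))
    (hp : φ * ζ ≤ p) :
    min c (c ^ 3) * (Ku⁻¹ ^ 3 * Kv⁻¹) * D ^ m ≤ 2 ^ 85 * (n + 1) ^ 5 * p := by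
  have hR0 : 0 < R := by linarith
  have hD0 : 0 < D := by linarith
  have hτ0 : 0 < τ := lt_of_lt_of_le (by positivity) hτ
  have hp0 : 0 ≤ p := (by positivity : 0 ≤ φ * ζ).trans hp
  have hn : (1 : ℝ) ≤ n + 1 := by linarith [Nat.cast_nonneg (α := ℝ) n]
  have hjn' : (j : ℝ) ≤ n + 1 := by
    have : (j : ℝ) ≤ n := by exact_mod_cast hjn
    linarith
  have hKu1 : Ku⁻¹ ≤ 1 := inv_le_one_of_one_le₀ hKu
  have hKv1 : Kv⁻¹ ≤ 1 := inv_le_one_of_one_le₀ hKv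
  have hKu0 : 0 < Ku := by linarith
  have hKv0 : 0 < Kv := by linarith
  -- Either the expected count dominates and the bound is linear in the data, or the error `E` does
  -- and everything is squared.
  rcases le_total (2 * j * E) (τ * ζ) with h | h
  · have h1 : τ * (c * (Ku⁻¹ * D ^ u)) ≤ τ * ((n + 1) * (M * (2048 * R⁻¹ * ζ))) := by
      calc _ ≤ _ := hI
        _ ≤ (n + 1) * (M * (1024 * R⁻¹ * (τ * ζ + τ * ζ))) := by
          have : I ≤ 1024 * R⁻¹ * (τ * ζ + τ * ζ) := hinc.trans (by gcongr)
          gcongr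
        _ = _ := by ring
    have h2 := le_of_mul_le_mul_left h1 hτ0
    have h3 : M * (c * Ku⁻¹ * D ^ m) ≤ M * (2 ^ 18 * (n + 1) * p) := by
      calc M * (c * Ku⁻¹ * D ^ m) = c * Ku⁻¹ * (D ^ m * M) := by ring
        _ ≤ c * Ku⁻¹ * (128 * φ * D ^ u * R) := by gcongr
        _ = 128 * φ * R * (c * (Ku⁻¹ * D ^ u)) := by ring
        _ ≤ 128 * φ * R * ((n + 1) * (M * (2048 * R⁻¹ * ζ))) := by gcongr
        _ = 2 ^ 18 * (n + 1) * M * (φ * ζ) * (R * R⁻¹) := by ring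
        _ = 2 ^ 18 * (n + 1) * M * (φ * ζ) := by rw [mul_inv_cancel₀ hR0.ne', mul_one]
        _ ≤ 2 ^ 18 * (n + 1) * M * p := by gcongr
        _ = _ := by ring
    have h4 := le_of_mul_le_mul_left h3 hM
    calc min c (c ^ 3) * (Ku⁻¹ ^ 3 * Kv⁻¹) * D ^ m ≤ c * (Ku⁻¹ * 1) * D ^ m := by
          have : Ku⁻¹ ^ 3 ≤ Ku⁻¹ := pow_le_of_le_one (by positivity) hKu1 (by norm_num)
          gcongr
          exact min_le_left _ _
      _ = c * Ku⁻¹ * D ^ m := by ring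
      _ ≤ 2 ^ 18 * (n + 1) * p := h4
      _ ≤ 2 ^ 85 * (n + 1) ^ 5 * p := by
          have : (n + 1 : ℝ) ≤ (n + 1) ^ 5 := le_self_pow₀ hn (by norm_num)
          gcongr
          · norm_num
          · norm_num
  · have h1 : τ * (c * (Ku⁻¹ * D ^ u)) ≤ (n + 1) * (M * (2 ^ 12 * R⁻¹ * ((n + 1) * E))) := by
      calc _ ≤ _ := hI
        _ ≤ (n + 1) * (M * (1024 * R⁻¹ * (2 * (n + 1) * E + 2 * (n + 1) * E))) := by
          have : I ≤ 1024 * R⁻¹ * (2 * (n + 1) * E + 2 * (n + 1) * E) := hinc.trans (by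
            have : 2 * j * E ≤ 2 * (n + 1) * E := by gcongr
            have h' := h.trans this
            gcongr)
          gcongr
        _ = _ := by ring
    -- Of the two factors `τ` on the left, one cancels against `E ^ 2`; the other is bounded below
    -- by `c * D ^ v`, which cancels `D ^ v` and makes the constant `c ^ 3`.
    have h2 : τ * (τ * (c ^ 2 * (Ku⁻¹ ^ 2 * (D ^ u) ^ 2))) ≤
        τ * (2 ^ 71 * (n + 1) ^ 5 * (M ^ 2 * A) * Kv * D ^ v * ζ * (R⁻¹ ^ 2 * R ^ e)) := by
      have := pow_le_pow_left₀ (by positivity) h1 2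
      calc _ = (τ * (c * (Ku⁻¹ * D ^ u))) ^ 2 := by ring
        _ ≤ _ := this
        _ = (n + 1) ^ 4 * M ^ 2 * 2 ^ 24 * R⁻¹ ^ 2 * E ^ 2 := by ring
        _ = _ := by rw [hE]; ring
    have h3 := le_of_mul_le_mul_left h2 hτ0
    have h4 : D ^ v * (c ^ 3 * Ku⁻¹ ^ 2 * (D ^ u) ^ 2) ≤
        D ^ v * (2 ^ 71 * (n + 1) ^ 5 * (M ^ 2 * A) * Kv * ζ * (R⁻¹ ^ 2 * R ^ e)) := by
      calc _ = c * D ^ v * (c ^ 2 * (Ku⁻¹ ^ 2 * (D ^ u) ^ 2)) := by ring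
        _ ≤ τ * (c ^ 2 * (Ku⁻¹ ^ 2 * (D ^ u) ^ 2)) := by gcongr
        _ ≤ _ := h3
        _ = _ := by ring
    have h5 := le_of_mul_le_mul_left h4 (by positivity)
    have hRe : R⁻¹ ^ 2 * R ^ e * R ^ (2 - e) = 1 := by
      rw [mul_assoc, ← Real.rpow_add hR0, show e + (2 - e) = (2 : ℕ) by push_cast; ring,
        Real.rpow_natCast, ← mul_pow, inv_mul_cancel₀ hR0.ne', one_pow]
    have h6 : (M ^ 2 * A) * (c ^ 3 * Ku⁻¹ ^ 3 * D ^ m) ≤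
        (M ^ 2 * A) * (2 ^ 85 * (n + 1) ^ 5 * Kv * p) := by
      calc _ = c ^ 3 * Ku⁻¹ ^ 3 * (D ^ m * (M ^ 2 * A)) := by ring
        _ ≤ c ^ 3 * Ku⁻¹ ^ 3 * (2 ^ 14 * Ku * φ * (D ^ u) ^ 2 * R ^ (2 - e)) := by gcongr
        _ = 2 ^ 14 * φ * R ^ (2 - e) * (c ^ 3 * Ku⁻¹ ^ 2 * (D ^ u) ^ 2) * (Ku⁻¹ * Ku) := by ring
        _ = 2 ^ 14 * φ * R ^ (2 - e) * (c ^ 3 * Ku⁻¹ ^ 2 * (D ^ u) ^ 2) := by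
            rw [inv_mul_cancel₀ hKu0.ne', mul_one]
        _ ≤ 2 ^ 14 * φ * R ^ (2 - e) *
            (2 ^ 71 * (n + 1) ^ 5 * (M ^ 2 * A) * Kv * ζ * (R⁻¹ ^ 2 * R ^ e)) := by gcongr
        _ = 2 ^ 85 * (n + 1) ^ 5 * (M ^ 2 * A) * Kv * (φ * ζ) *
            (R⁻¹ ^ 2 * R ^ e * R ^ (2 - e)) := by ring
        _ = 2 ^ 85 * (n + 1) ^ 5 * (M ^ 2 * A) * Kv * (φ * ζ) := by rw [hRe, mul_one]
        _ ≤ 2 ^ 85 * (n + 1) ^ 5 * (M ^ 2 * A) * Kv * p := by gcongr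
        _ = _ := by ring
    have h7 := le_of_mul_le_mul_left h6 (by positivity)
    calc min c (c ^ 3) * (Ku⁻¹ ^ 3 * Kv⁻¹) * D ^ m
        ≤ c ^ 3 * (Ku⁻¹ ^ 3 * Kv⁻¹) * D ^ m := by
          gcongr
          exact min_le_right _ _
      _ = Kv⁻¹ * (c ^ 3 * Ku⁻¹ ^ 3 * D ^ m) := by ring
      _ ≤ Kv⁻¹ * (2 ^ 85 * (n + 1) ^ 5 * Kv * p) := by gcongr
      _ = 2 ^ 85 * (n + 1) ^ 5 * p * (Kv⁻¹ * Kv) := by ring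
      _ = _ := by rw [inv_mul_cancel₀ hKv0.ne', mul_one]

/-- The contribution of the scale `2⁻ⁱ` to the incidence estimate at the scale `2⁻ʲ`. -/
theorem energy_bound {D Kv A v m τ ζ : ℝ} {i j n : ℕ} (hD0 : 0 < D) (hKv : 0 ≤ Kv) (hv2 : v ≤ 2)
    (hA : 0 ≤ A) (hτ : 0 ≤ τ) (hζ : 0 ≤ ζ) (hi : i ≤ j) (hj : j ≤ n) :
    τ * ((2 ^ i) ^ 2 * (Kv * (128 * (2 * (2 ^ i)⁻¹) * D) ^ v) *
        (ζ * ((j + 1) * (2 ^ 31 * A * 2 ^ i * 2 ^ (((j : ℝ) - i) * m)))))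
      ≤ τ * ζ * ((n + 1) * (2 ^ 47 * Kv * A * D ^ v * (2 ^ j) ^ max m (3 - v))) := by
  set R : ℝ := 2 ^ j with hR
  set B : ℝ := 2 ^ i with hB
  have hB1 : 1 ≤ B := one_le_pow₀ (by norm_num)
  have hB0 : 0 < B := by linarith
  have hBR : B ≤ R := pow_le_pow_right₀ (by norm_num) hi
  have hNi : Kv * (128 * (2 * B⁻¹) * D) ^ v ≤ Kv * (2 ^ 16 * B ^ (-v) * D ^ v) := by
    have e1 : (128 * (2 * B⁻¹) * D) ^ v = 256 ^ v * B ^ (-v) * D ^ v := by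
      rw [show 128 * (2 * B⁻¹) * D = 256 * B⁻¹ * D by ring,
        Real.mul_rpow (by positivity) hD0.le, Real.mul_rpow (by norm_num) (by positivity),
        Real.inv_rpow hB0.le, Real.rpow_neg hB0.le]
    have e2 : (256 : ℝ) ^ v ≤ 2 ^ 16 := by
      calc (256 : ℝ) ^ v ≤ 256 ^ (2 : ℝ) :=
            Real.rpow_le_rpow_of_exponent_le (by norm_num) hv2
        _ = 2 ^ 16 := by norm_num
    rw [e1]
    gcongr
  have hpow : (2 : ℝ) ^ (((j : ℝ) - i) * m) = R ^ m * B ^ (-m) := by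
    rw [hR, hB, ← Real.rpow_natCast 2 j, ← Real.rpow_natCast 2 i,
      ← Real.rpow_mul (by norm_num), ← Real.rpow_mul (by norm_num),
      ← Real.rpow_add (by norm_num)]
    congr 1
    ring
  -- The factors stem from localising the `L²` norm to squares, the count of lines in a square, the
  -- size of the kernel, and the Frostman condition, in this order.
  have hcomb : B ^ 2 * B ^ (-v) * B * (R ^ m * B ^ (-m)) ≤ R ^ max m (3 - v) := by
    refine le_trans (le_of_eq ?_) (rpow_mul_rpow_le (a := 3 - v) (m := m) hB1 hBR)
    have e3 : B ^ (3 - v - m) = B ^ (3 : ℝ) * B ^ (-v) * B ^ (-m) := by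
      rw [← Real.rpow_add hB0, ← Real.rpow_add hB0]
      congr 1
    have e4 : B ^ (3 : ℝ) = B ^ 3 := by
      rw [← Real.rpow_natCast]; norm_num
    rw [e3, e4]
    ring
  have hjn' : (j : ℝ) ≤ n := by exact_mod_cast hj
  rw [hpow]
  calc τ * (B ^ 2 * (Kv * (128 * (2 * B⁻¹) * D) ^ v) * (ζ * ((j + 1) * (2 ^ 31 * A * B * (R ^ m * B ^ (-m))))))
      ≤ τ * (B ^ 2 * (Kv * (2 ^ 16 * B ^ (-v) * D ^ v)) *
        (ζ * ((n + 1) * (2 ^ 31 * A * B * (R ^ m * B ^ (-m)))))) := by gcongr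
    _ = τ * ζ * ((n + 1) * (2 ^ 47 * Kv * A * D ^ v *
        (B ^ 2 * B ^ (-v) * B * (R ^ m * B ^ (-m))))) := by ring
    _ ≤ _ := by gcongr

/-! ### Furstenberg sets in coordinates -/

/-- A configuration of lines `ℓ t` and points `(X p, Y p)`, where `S t` consists of points close to
the line `ℓ t`, with the spacing conditions of a Furstenberg set. -/
structure IsConfiguration {ι κ : Type*} (c δ u v Ku Kv : ℝ) (T : Finset ι) (ℓ : ι → ℝ × ℝ)
    (P : Finset κ) (X Y : κ → ℝ) (S : ι → Finset κ) : Prop where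
  slope : ∀ t ∈ T, |(ℓ t).1| ≤ 1
  X_mem : ∀ p ∈ P, X p ∈ Icc (0 : ℝ) 1
  Y_mem : ∀ p ∈ P, Y p ∈ Icc (0 : ℝ) 1
  subset : ∀ t ∈ T, S t ⊆ P
  near : ∀ t ∈ T, ∀ p ∈ S t, |Y p - (ℓ t).1 * X p - (ℓ t).2| ≤ 4 * δ
  lines : ∀ z : ℝ × ℝ, ∀ w, δ / 32 ≤ w →
    ((T.filter (fun t => z ∈ closedBall (ℓ t) w)).card : ℝ) ≤ Kv * (128 * w * δ⁻¹) ^ v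
  points : ∀ t ∈ T, ∀ x y w, δ / 32 ≤ w →
    (((S t).filter (fun p => |X p - x| ≤ w ∧ |Y p - y| ≤ w)).card : ℝ)
      ≤ Ku * (128 * w * δ⁻¹) ^ u
  separated : ∀ p ∈ P, ∀ q ∈ P, |X p - X q| ≤ δ / 16 → |Y p - Y q| ≤ δ / 16 → p = q
  card_lines : c * δ⁻¹ ^ v ≤ (T.card : ℝ)
  card_points : ∀ t ∈ T, c * (Ku⁻¹ * δ⁻¹ ^ u) ≤ ((S t).card : ℝ)

/-- The incidences of a configuration are counted by a covering of its points by cells. -/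
theorem IsConfiguration.exists_level {ι κ : Type*} {c δ u v Ku Kv : ℝ} {T : Finset ι}
    {ℓ : ι → ℝ × ℝ} {P : Finset κ} {X Y : κ → ℝ} {S : ι → Finset κ}
    (h : IsConfiguration c δ u v Ku Kv T ℓ P X Y S) {n : ℕ}
    (hn : δ ≤ 32 * (2 ^ n)⁻¹) (Z : ℕ → Finset κ)
    (hcov : ∀ p ∈ P, ∃ j ≤ n, ∃ z ∈ Z j, dyadicCell j (X z) (Y z) = dyadicCell j (X p) (Y p))
    (M : ℕ → ℝ)
    (hM : ∀ j ≤ n, ∀ t ∈ T, ∀ z, (((S t).filter (fun p =>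
      dyadicCell j (X p) (Y p) = dyadicCell j (X z) (Y z))).card : ℝ) ≤ M j) :
    ∃ j ≤ n, (T.card : ℝ) * (c * (Ku⁻¹ * δ⁻¹ ^ u)) ≤ (n + 1) * (M j * ∑ z ∈ Z j,
      ((T.filter (fun t => |Y z - (ℓ t).1 * X z - (ℓ t).2| ≤ 132 * (2 ^ j)⁻¹)).card : ℝ)) := by
  set I : ℕ → ℝ := fun j => ∑ z ∈ Z j,
    ((T.filter (fun t => |Y z - (ℓ t).1 * X z - (ℓ t).2| ≤ 132 * (2 ^ j)⁻¹)).card : ℝ) with hI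
  have hcell : ∀ t ∈ T, ∀ j ≤ n, ∀ z, (((S t).filter (fun p =>
      dyadicCell j (X p) (Y p) = dyadicCell j (X z) (Y z))).card : ℝ) ≤
      if |Y z - (ℓ t).1 * X z - (ℓ t).2| ≤ 132 * (2 ^ j)⁻¹ then M j else 0 := by
    intro t ht j hj z
    split_ifs with hz
    · exact hM j hj t ht z
    -- If the cell of `z` held a point of `S t`, then `z` would be near the line: `4 δ ≤ 128 · 2⁻ʲ`,
    -- and moving inside the cell adds `2⁻ʲ` for each coordinate.
    · rw [Finset.filter_eq_empty_iff.2, Finset.card_empty, Nat.cast_zero]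
      intro p hp hpz
      apply hz
      simp only [dyadicCell, Prod.mk.injEq] at hpz
      have h1 := abs_sub_le_of_floor_eq hpz.1
      have h2 := abs_sub_le_of_floor_eq hpz.2
      have h3 := h.near t ht p hp
      have h4 := h.slope t ht
      have h5 : (2 ^ n : ℝ)⁻¹ ≤ (2 ^ j)⁻¹ :=
        inv_anti₀ (by positivity) (pow_le_pow_right₀ (by norm_num) hj)
      have h6 : |(ℓ t).1 * (X p - X z)| ≤ (2 ^ j)⁻¹ := by
        rw [abs_mul]
        exact (mul_le_of_le_one_left (abs_nonneg _) h4).trans h1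
      rw [abs_le] at *
      constructor <;> linarith [h2.1, h2.2, h3.1, h3.2, h6.1, h6.2]
  have hS : ∀ t ∈ T, ((S t).card : ℝ) ≤ ∑ j ∈ Finset.range (n + 1), ∑ z ∈ Z j,
      if |Y z - (ℓ t).1 * X z - (ℓ t).2| ≤ 132 * (2 ^ j)⁻¹ then M j else 0 := by
    intro t ht
    have hsub : S t ⊆ (Finset.range (n + 1)).biUnion fun j => (Z j).biUnion fun z =>
        (S t).filter (fun p => dyadicCell j (X p) (Y p) = dyadicCell j (X z) (Y z)) := by
      intro p hp
      obtain ⟨j, hj, z, hz, hzp⟩ := hcov p (h.subset t ht hp)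
      simp only [Finset.mem_biUnion, Finset.mem_range, Finset.mem_filter]
      exact ⟨j, by omega, z, hz, hp, hzp.symm⟩
    calc ((S t).card : ℝ) ≤ ((∑ j ∈ Finset.range (n + 1), ∑ z ∈ Z j, ((S t).filter (fun p =>
            dyadicCell j (X p) (Y p) = dyadicCell j (X z) (Y z))).card : ℕ) : ℝ) := by
          refine Nat.cast_le.2 ((Finset.card_le_card hsub).trans (Finset.card_biUnion_le.trans ?_))
          exact Finset.sum_le_sum fun j _ => Finset.card_biUnion_le
      _ ≤ _ := by
          push_cast
          refine Finset.sum_le_sum fun j hj => Finset.sum_le_sum fun z _ => ?_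
          exact hcell t ht j (by rw [Finset.mem_range] at hj; omega) z
  have htotal : (T.card : ℝ) * (c * (Ku⁻¹ * δ⁻¹ ^ u)) ≤ ∑ j ∈ Finset.range (n + 1), M j * I j := by
    calc (T.card : ℝ) * (c * (Ku⁻¹ * δ⁻¹ ^ u)) = ∑ _t ∈ T, c * (Ku⁻¹ * δ⁻¹ ^ u) := by
          rw [Finset.sum_const, nsmul_eq_mul]
      _ ≤ ∑ t ∈ T, ∑ j ∈ Finset.range (n + 1), ∑ z ∈ Z j,
          (if |Y z - (ℓ t).1 * X z - (ℓ t).2| ≤ 132 * (2 ^ j)⁻¹ then M j else 0) :=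
          Finset.sum_le_sum fun t ht => (h.card_points t ht).trans (hS t ht)
      _ = _ := by
          rw [Finset.sum_comm]
          refine Finset.sum_congr rfl fun j _ => ?_
          rw [Finset.sum_comm, hI, Finset.mul_sum]
          refine Finset.sum_congr rfl fun z _ => ?_
          rw [← Finset.sum_filter, Finset.sum_const, nsmul_eq_mul, mul_comm]
  obtain ⟨j, hj, hmax⟩ := Finset.exists_max_image (Finset.range (n + 1)) (fun j => M j * I j)
    ⟨0, by simp⟩
  refine ⟨j, by rw [Finset.mem_range] at hj; omega, htotal.trans ?_⟩
  calc _ ≤ ∑ _j ∈ Finset.range (n + 1), M j * I j := Finset.sum_le_sum hmax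
    _ = _ := by rw [Finset.sum_const, Finset.card_range, nsmul_eq_mul]; push_cast; ring

/-- The finest level is treated separately: its cells hold at most one point, so they cost `1` and
`M` is free of `Ku`, while the Frostman constant `A` becomes `Ku`. On coarser levels `Ku` cancels in
the ratios of costs but enters `M`. In both cases `M ^ 2 * A` carries the same power of `Ku` as `Ku
* φ`, which is how the total loss stays at `Ku ^ 3`. -/
theorem IsConfiguration.card_ge {ι κ : Type*} {c δ u v Ku Kv : ℝ} {T : Finset ι}
    {ℓ : ι → ℝ × ℝ} {P : Finset κ} {X Y : κ → ℝ} {S : ι → Finset κ}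
    (h : IsConfiguration c δ u v Ku Kv T ℓ P X Y S) (hc : 0 < c) (hu : 0 < u) (hu1 : u ≤ 1)
    (hv : 1 ≤ v) (hv2 : v ≤ 2) (hδ : 0 < δ) (hδ1 : δ ≤ 1) (hKu : 1 ≤ Ku) (hKv : 1 ≤ Kv)
    {n : ℕ} (hn : δ ≤ 32 * (2 ^ n)⁻¹) (hn' : (2 ^ n)⁻¹ ≤ δ / 16) :
    min c (c ^ 3) * (Ku⁻¹ ^ 3 * Kv⁻¹) * δ⁻¹ ^ min (2 * u + v - 1) (u + 1)
      ≤ 2 ^ 85 * (n + 1) ^ 5 * (P.card : ℝ) := by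
  set m := min (2 * u + v - 1) (u + 1) with hm
  set D := δ⁻¹ with hDdef
  have hD : 1 ≤ D := (one_le_inv₀ hδ).2 hδ1
  have hD0 : 0 < D := by linarith
  have hm1 : m ≤ u + 1 := min_le_right _ _
  have hm2 : m ≤ 2 * u + v - 1 := min_le_left _ _
  have hm0 : 0 ≤ m := le_min (by linarith) (by linarith)
  have hKu0 : 0 < Ku := by linarith
  have hKv0 : 0 < Kv := by linarith
  -- The exponent of `2 ^ j` in the largest energy term; the two bounds on `m` are what `hme`
  -- requires.
  set e := max m (3 - v) with he
  have he2 : e ≤ 2 := max_le (by linarith) (by linarith)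
  have hme : m + e ≤ 2 * u + 2 := by
    rcases max_cases m (3 - v) with h' | h' <;> rw [he, h'.1] <;> linarith
  have hDn : D ≤ 2 ^ n := by
    have : (2 ^ n : ℝ)⁻¹ ≤ δ := hn'.trans (by linarith)
    rw [hDdef]
    exact (inv_le_comm₀ (by positivity) hδ).1 this
  -- the gauge of the covering, and the number of points of one line in a cell
  set φ : ℕ → ℝ := fun j => if j = n then 1 else Ku * 2 ^ (((n : ℝ) - j) * m) with hφ
  set M : ℕ → ℝ := fun j => if j = n then 1 else Ku * (128 * (2 ^ j)⁻¹ * D) ^ u with hM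
  set A : ℕ → ℝ := fun j => if j = n then Ku else 1 with hA
  have hφ0 : ∀ j, 0 < φ j := fun j => by simp only [hφ]; split_ifs <;> positivity
  have hM0 : ∀ j, 0 < M j := fun j => by simp only [hM]; split_ifs <;> positivity
  have hA0 : ∀ j, 0 < A j := fun j => by simp only [hA]; split_ifs <;> positivity
  obtain ⟨Z, hZP, hcov, hfrost, hcost⟩ := exists_minimal_cover P n
    (fun j p => dyadicCell j (X p) (Y p)) (fun l j p q hlj hpq => dyadicCell_eq_of_le hlj hpq) φ
    (fun j => (hφ0 j).le)
  have hMcard : ∀ j ≤ n, ∀ t ∈ T, ∀ z, (((S t).filter (fun p =>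
      dyadicCell j (X p) (Y p) = dyadicCell j (X z) (Y z))).card : ℝ) ≤ M j := by
    intro j hj t ht z
    simp only [hM]
    split_ifs with hjn
    · have : ((S t).filter (fun p =>
          dyadicCell j (X p) (Y p) = dyadicCell j (X z) (Y z))).card ≤ 1 := by
        rw [Finset.card_le_one]
        intro p hp q hq
        rw [Finset.mem_filter] at hp hq
        have hpq := hp.2.trans hq.2.symm
        simp only [dyadicCell, Prod.mk.injEq] at hpq
        rw [hjn] at hpq
        exact h.separated p (h.subset t ht hp.1) q (h.subset t ht hq.1)
          ((abs_sub_le_of_floor_eq hpq.1).trans hn') ((abs_sub_le_of_floor_eq hpq.2).trans hn')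
      exact_mod_cast this
    · have hw : δ / 32 ≤ (2 ^ j : ℝ)⁻¹ := by
        have : (2 ^ n : ℝ)⁻¹ ≤ (2 ^ j)⁻¹ :=
          inv_anti₀ (by positivity) (pow_le_pow_right₀ (by norm_num) hj)
        linarith
      refine le_trans ?_ (h.points t ht (X z) (Y z) _ hw)
      refine Nat.cast_le.2 (Finset.card_le_card (Finset.monotone_filter_right _ fun p _ hp => ?_))
      simp only [dyadicCell, Prod.mk.injEq] at hp
      exact ⟨abs_sub_le_of_floor_eq hp.1, abs_sub_le_of_floor_eq hp.2⟩
  obtain ⟨j, hj, hI⟩ := h.exists_level hn Z hcov M hMcard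
  have hfrost' : ∀ l ≤ j, ∀ k,
      (((Z j).filter (fun z => dyadicCell l (X z) (Y z) = k)).card : ℝ)
        ≤ A j * 2 ^ (((j : ℝ) - l) * m) := by
    intro l hl k
    have h1 := hfrost l j hl hj k
    have hjn : j = n ∨ j < n := hj.eq_or_lt
    rcases hjn with rfl | hjn
    · simp only [hφ, hA, if_true, one_mul] at h1 ⊢
      refine h1.trans ?_
      split_ifs with hln
      · rw [hln, sub_self, zero_mul, Real.rpow_zero, mul_one]
        exact hKu
      · exact le_rfl
    · simp only [hφ, hA, if_neg hjn.ne, if_neg (hl.trans_lt hjn).ne] at h1 ⊢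
      have e1 : Ku * (2 : ℝ) ^ (((n : ℝ) - l) * m)
          = Ku * 2 ^ (((n : ℝ) - j) * m) * 2 ^ (((j : ℝ) - l) * m) := by
        rw [mul_assoc, ← Real.rpow_add (by norm_num)]
        congr 2
        ring
      rw [e1] at h1
      rw [one_mul]
      exact le_of_mul_le_mul_left h1 (by positivity)
  set R : ℝ := 2 ^ j with hR
  have hR1 : 1 ≤ R := one_le_pow₀ (by norm_num)
  have hR0 : 0 < R := by linarith
  set N : ℕ → ℝ := fun i => Kv * (128 * (2 * (2 ^ i)⁻¹) * D) ^ v with hN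
  set τ : ℝ := (T.card : ℝ) with hτ
  set ζ : ℝ := ((Z j).card : ℝ) with hζ
  have hτ0 : 0 ≤ τ := Nat.cast_nonneg _
  have hζ0 : 0 ≤ ζ := Nat.cast_nonneg _
  have hAj := hA0 j
  set E2 : ℝ := τ * ζ * ((n + 1) * (2 ^ 47 * Kv * A j * D ^ v * R ^ e)) with hE2
  have hE20 : 0 ≤ E2 := by positivity
  have hinc := incidence_le T ℓ h.slope (Z j) X Y (fun z hz => h.X_mem z (hZP j hz))
    (fun z hz => h.Y_mem z (hZP j hz)) j (hA0 j).le (m := m) (by linarith) hfrost' N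
    (fun i hi z => by
      refine h.lines z _ ?_
      have : (2 ^ n : ℝ)⁻¹ ≤ (2 ^ i)⁻¹ :=
        inv_anti₀ (by positivity) (pow_le_pow_right₀ (by norm_num) (hi.trans hj))
      have : (0 : ℝ) < (2 ^ n)⁻¹ := by positivity
      linarith)
    (Real.sqrt_nonneg E2) (by
      intro i hi
      rw [Real.sq_sqrt hE20]
      exact energy_bound hD0 hKv0.le hv2 hAj.le hτ0 hζ0 hi hj)
  have hlowhigh : D ^ m * M j ≤ 128 * φ j * D ^ u * R ∧
      D ^ m * (M j ^ 2 * A j) ≤ 2 ^ 14 * Ku * φ j * (D ^ u) ^ 2 * R ^ (2 - e) := by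
    rcases hj.eq_or_lt with hjn | hjn
    · simp only [hφ, hM, hA, if_pos hjn]
      have hDR : D ≤ R := by rw [hR, hjn]; exact hDn
      have h1 := fine_low hD hDR hm1
      have h2 := fine_high hD hDR he2 hme
      constructor
      · calc D ^ m * 1 ≤ D ^ u * R := by rwa [mul_one]
          _ ≤ 128 * (D ^ u * R) := le_mul_of_one_le_left (by positivity) (by norm_num)
          _ = _ := by ring
      · calc D ^ m * (1 ^ 2 * Ku) = Ku * D ^ m := by ring
          _ ≤ Ku * ((D ^ u) ^ 2 * R ^ (2 - e)) := by gcongr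
          _ ≤ 2 ^ 14 * (Ku * ((D ^ u) ^ 2 * R ^ (2 - e))) :=
            le_mul_of_one_le_left (by positivity) (by norm_num)
          _ = _ := by ring
    · simp only [hφ, hM, hA, if_neg hjn.ne]
      have hs : 0 < R⁻¹ * D := by positivity
      have hRs : R * (R⁻¹ * D) = D := by rw [← mul_assoc, mul_inv_cancel₀ hR0.ne', one_mul]
      have hQ : R⁻¹ * D ≤ (2 : ℝ) ^ ((n : ℝ) - j) := by
        rw [Real.rpow_sub (by norm_num), Real.rpow_natCast, Real.rpow_natCast, ← hR,
          div_eq_mul_inv, mul_comm]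
        gcongr
      have h1 := coarse_low hs hQ hR1 hu1 hm0 hm1
      have h2 := coarse_high hs hQ hR1 hu1 hm0 hme
      rw [hRs, ← mul_assoc, ← Real.rpow_mul (by norm_num)] at h1 h2
      constructor
      · calc D ^ m * (Ku * (128 * R⁻¹ * D) ^ u) = Ku * (D ^ m * (128 * R⁻¹ * D) ^ u) := by ring
          _ ≤ Ku * (128 * 2 ^ (((n : ℝ) - j) * m) * D ^ u * R) := by gcongr
          _ = _ := by ring
      · calc D ^ m * ((Ku * (128 * R⁻¹ * D) ^ u) ^ 2 * 1)
            = Ku ^ 2 * (D ^ m * ((128 * R⁻¹ * D) ^ u) ^ 2) := by ring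
          _ ≤ Ku ^ 2 * (2 ^ 14 * 2 ^ (((n : ℝ) - j) * m) * (D ^ u) ^ 2 * R ^ (2 - e)) := by gcongr
          _ = _ := by ring
  have hφn : φ n = 1 := by simp [hφ]
  have hcj := hcost j hj
  rw [hφn, one_mul] at hcj
  exact card_ge_of_incidence hc hD hKu hKv (hM0 j) hAj (hφ0 j) hζ0 hR1 hj (Real.sqrt_nonneg E2)
    h.card_lines hI hinc (Real.sq_sqrt hE20) hlowhigh.1 hlowhigh.2 hcj

/-- Powers of the number of dyadic scales are negligible. -/
theorem exists_const_scales (ε : ℝ) (hε : 0 < ε) : ∃ B : ℝ, 0 < B ∧ ∀ (n : ℕ) (D : ℝ), 1 ≤ D →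
    2 ^ n ≤ 32 * D → ((n : ℝ) + 1) ^ 5 ≤ B * D ^ ε := by
  have hx0 : (0 : ℝ) < 2 ^ (-ε) := by positivity
  have hx1 : (2 : ℝ) ^ (-ε) < 1 := Real.rpow_lt_one_of_one_lt_of_neg (by norm_num) (by linarith)
  have ht := tendsto_pow_const_mul_const_pow_of_abs_lt_one 5
    (show |(2 : ℝ) ^ (-ε)| < 1 by rwa [abs_of_pos hx0])
  obtain ⟨b, hb⟩ := ht.bddAbove_range
  have hb' : ∀ n : ℕ, (n : ℝ) ^ 5 * ((2 : ℝ) ^ (-ε)) ^ n ≤ b := fun n => hb ⟨n, rfl⟩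
  have hb0 : 0 < b := lt_of_lt_of_le (by positivity) (hb' 1)
  refine ⟨b * 64 ^ ε, by positivity, fun n D hD hn => ?_⟩
  have h1 := hb' (n + 1)
  have h2 : ((2 : ℝ) ^ (-ε)) ^ (n + 1) = ((2 ^ (n + 1) : ℝ) ^ ε)⁻¹ := by
    rw [← Real.rpow_natCast, ← Real.rpow_natCast, ← Real.rpow_mul (by norm_num),
      ← Real.rpow_mul (by norm_num), ← Real.rpow_neg (by norm_num)]
    congr 1
    ring
  rw [h2, ← div_eq_mul_inv, div_le_iff₀ (by positivity)] at h1
  push_cast at h1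
  refine h1.trans ?_
  have h3 : (2 ^ (n + 1) : ℝ) ^ ε ≤ (64 * D) ^ ε :=
    Real.rpow_le_rpow (by positivity) (by rw [pow_succ]; linarith) hε.le
  rw [Real.mul_rpow (by norm_num) (by linarith)] at h3
  calc b * (2 ^ (n + 1) : ℝ) ^ ε ≤ b * (64 ^ ε * D ^ ε) := by gcongr
    _ = _ := by ring

/-- With `2⁻ⁿ ≤ δ / 16` cells of level `n` separate the points; with `2⁻ⁿ ≥ δ / 32` the spacing
conditions are available on every level. -/
theorem exists_dyadic_scale {δ : ℝ} (hδ : 0 < δ) (hδ1 : δ ≤ 1) :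
    ∃ n : ℕ, δ ≤ 32 * (2 ^ n : ℝ)⁻¹ ∧ (2 ^ n : ℝ)⁻¹ ≤ δ / 16 := by
  obtain ⟨n, h1, h2⟩ := exists_nat_pow_near_of_lt_one (x := δ / 16) (y := 1 / 2) (by positivity)
    (by linarith) (by norm_num) (by norm_num)
  refine ⟨n + 1, ?_, ?_⟩
  · rw [one_div, inv_pow] at h2
    rw [pow_succ, mul_inv]
    linarith
  · rw [one_div, inv_pow] at h1
    exact h1.le

/-- The lower bound for the number of points of a configuration. -/
theorem IsConfiguration.exists_const (ε : ℝ) (hε : 0 < ε) (c : ℝ) (hc : 0 < c) :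
    ∃ C : ℝ, 0 < C ∧ ∀ (u v δ Ku Kv : ℝ), 0 < u → u ≤ 1 → 1 ≤ v → v ≤ 2 → 0 < δ → δ ≤ 1 →
      1 ≤ Ku → 1 ≤ Kv → ∀ {ι κ : Type} {T : Finset ι} {ℓ : ι → ℝ × ℝ} {P : Finset κ} {X Y : κ → ℝ}
      {S : ι → Finset κ}, IsConfiguration c δ u v Ku Kv T ℓ P X Y S →
        C * Ku ^ (-3 : ℤ) * Kv ^ (-1 : ℤ) * δ⁻¹ ^ (min (2 * u + v - 1) (u + 1) - ε)
          ≤ (P.card : ℝ) := by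
  obtain ⟨B, hB, hscale⟩ := exists_const_scales ε hε
  have hcc : 0 < min c (c ^ 3) := lt_min hc (by positivity)
  refine ⟨min c (c ^ 3) / (2 ^ 85 * B), by positivity, ?_⟩
  intro u v δ Ku Kv hu hu1 hv hv2 hδ hδ1 hKu hKv ι κ T ℓ P X Y S h
  obtain ⟨n, hn, hn'⟩ := exists_dyadic_scale hδ hδ1
  have hmain := h.card_ge hc hu hu1 hv hv2 hδ hδ1 hKu hKv hn hn'
  have hD : 1 ≤ δ⁻¹ := (one_le_inv₀ hδ).2 hδ1
  have hD0 : 0 < δ⁻¹ := by linarith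
  have hs := hscale n δ⁻¹ hD (by
    have h1 : δ * 2 ^ n ≤ 32 := by rwa [← div_eq_mul_inv, le_div_iff₀ (by positivity)] at hn
    rw [← div_eq_mul_inv, le_div_iff₀ hδ]
    linarith)
  have e1 : Ku ^ (-3 : ℤ) = Ku⁻¹ ^ 3 := by rw [zpow_neg, inv_pow]; norm_cast
  have e2 : Kv ^ (-1 : ℤ) = Kv⁻¹ := zpow_neg_one _
  rw [e1, e2, Real.rpow_sub hD0]
  set G := δ⁻¹ ^ min (2 * u + v - 1) (u + 1) with hG
  have hDε : 0 < δ⁻¹ ^ ε := by positivity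
  rw [show min c (c ^ 3) / (2 ^ 85 * B) * Ku⁻¹ ^ 3 * Kv⁻¹ * (G / δ⁻¹ ^ ε)
    = (min c (c ^ 3) * (Ku⁻¹ ^ 3 * Kv⁻¹) * G) / (2 ^ 85 * (B * δ⁻¹ ^ ε)) by
      field_simp, div_le_iff₀ (by positivity)]
  calc _ ≤ _ := hmain
    _ ≤ 2 ^ 85 * (B * δ⁻¹ ^ ε) * (P.card : ℝ) := by gcongr
    _ = _ := by ring

/-! ### Plane geometry in coordinates -/

theorem inner_eq_coord {i i' : Fin 2} (h : i ≠ i') (y z : Plane) :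
    inner ℝ y z = y i * z i + y i' * z i' := by
  rw [PiLp.inner_apply, Fin.sum_univ_two]
  fin_cases i <;> fin_cases i' <;> first | exact absurd rfl h | skip
  · simp [mul_comm]
  · simp [mul_comm, add_comm]

theorem norm_sq_eq_coord {i i' : Fin 2} (h : i ≠ i') (y : Plane) :
    ‖y‖ ^ 2 = y i ^ 2 + y i' ^ 2 := by
  rw [← real_inner_self_eq_norm_sq, inner_eq_coord h]
  ring

theorem norm_le_coord {i i' : Fin 2} (h : i ≠ i') (y : Plane) : ‖y‖ ≤ |y i| + |y i'| := by
  refine abs_le_of_sq_le_sq' ?_ (by positivity) |>.2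
  rw [norm_sq_eq_coord h, ← sq_abs (y i), ← sq_abs (y i')]
  nlinarith [abs_nonneg (y i), abs_nonneg (y i')]

theorem abs_coord_le_norm (i : Fin 2) (y : Plane) : |y i| ≤ ‖y‖ := PiLp.norm_apply_le y i

/-- The point whose coordinates are `a` in the direction `i` and `b` in the other direction. -/
def mkPoint (i : Fin 2) (a b : ℝ) : Plane := WithLp.toLp 2 (fun k => if k = i then a else b)

theorem mkPoint_apply_self (i : Fin 2) (a b : ℝ) : mkPoint i a b i = a := by
  simp [mkPoint]

theorem mkPoint_apply_of_ne {i i' : Fin 2} (h : i ≠ i') (a b : ℝ) : mkPoint i a b i' = b := by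
  simp [mkPoint, h.symm]

/-- `ℓ = (a, b)` is the line `y = a x + b` of slope at most one, where `x`, `y` are the coordinates
`i`, `i'`, and the set `t` lies in its vertical neighbourhood of size `δ`. -/
def IsCoreLine (i i' : Fin 2) (δ : ℝ) (t : Set Plane) (ℓ : ℝ × ℝ) : Prop :=
  |ℓ.1| ≤ 1 ∧ ∀ y ∈ t, |y i' - ℓ.1 * y i - ℓ.2| ≤ δ

/-- The long side is at most 45 degrees from the axis `i`, so `|f i| ≥ 1 / 2`. Vertical distance to
the core is the orthogonal distance, at most `δ / 2`, divided by `|f i|`. -/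
theorem exists_isCoreLine_of_le {i i' : Fin 2} (h : i ≠ i') {δ : ℝ} {x e f : Plane}
    (he : ‖e‖ = 1) (hf : ‖f‖ = 1) (hef : inner ℝ e f = 0) (hle : |f i'| ≤ |f i|) :
    ∃ ℓ, IsCoreLine i i' δ {y | |inner ℝ (y - x) e| ≤ δ / 2 ∧ |inner ℝ (y - x) f| ≤ 1 / 2} ℓ := by
  have hf2 : f i ^ 2 + f i' ^ 2 = 1 := by rw [← norm_sq_eq_coord h, hf, one_pow]
  have he2 : e i ^ 2 + e i' ^ 2 = 1 := by rw [← norm_sq_eq_coord h, he, one_pow]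
  rw [inner_eq_coord h] at hef
  have hfi : 1 / 2 ≤ |f i| := by
    have h1 : |f i'| ^ 2 ≤ |f i| ^ 2 := by gcongr
    rw [← sq_abs (f i), ← sq_abs (f i')] at hf2
    nlinarith [abs_nonneg (f i)]
  have hfi0 : f i ≠ 0 := abs_pos.1 (by linarith)
  refine ⟨(f i' / f i, x i' - f i' / f i * x i), ?_, fun y hy => ?_⟩
  · dsimp only
    rw [abs_div]
    exact div_le_one_of_le₀ hle (abs_nonneg _)
  · have hy1 := hy.1
    rw [inner_eq_coord h] at hy1
    simp only [PiLp.sub_apply] at hy1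
    -- The orientation of the frame: `s = ±1`, and `e` is `s` times the quarter turn of `f`.
    set s := e i' * f i - e i * f i' with hs
    have e1 : e i = - s * f i' := by
      rw [hs]
      linear_combination (-(e i)) * hf2 + f i * hef
    have e2 : e i' = s * f i := by
      rw [hs]
      linear_combination (-(e i')) * hf2 + f i' * hef
    have hs1 : |s| = 1 := by
      have : s ^ 2 = 1 := by
        rw [e1, e2] at he2
        linear_combination he2 - s ^ 2 * hf2
      rw [← sq_abs] at this
      exact (pow_eq_one_iff_of_nonneg (abs_nonneg s) (by norm_num)).1 this
    have e3 : (y i - x i) * e i + (y i' - x i') * e i' =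
        s * (f i * (y i' - f i' / f i * y i - (x i' - f i' / f i * x i))) := by
      rw [e1, e2]
      field_simp
      ring
    rw [e3, abs_mul, hs1, one_mul, abs_mul] at hy1
    dsimp only
    nlinarith [abs_nonneg (y i' - f i' / f i * y i - (x i' - f i' / f i * x i))]

theorem IsTube.exists_isCoreLine {δ : ℝ} {t : Set Plane} (ht : IsTube δ t) :
    (∃ ℓ, IsCoreLine 0 1 δ t ℓ) ∨ ∃ ℓ, IsCoreLine 1 0 δ t ℓ := by
  obtain ⟨x, e, f, he, hf, hef, rfl⟩ := ht
  rcases le_total |f 1| |f 0| with h | h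
  · exact Or.inl (exists_isCoreLine_of_le (by decide) he hf hef h)
  · exact Or.inr (exists_isCoreLine_of_le (by decide) he hf hef h)

/-- The rectangle is centred at the projection of the square's centre to the line. Points of the
square are within distance `1` of its centre, so length `2` suffices, and orthogonal distance is at
most vertical distance. -/
theorem exists_rectangle {i i' : Fin 2} (h : i ≠ i') (a b W : ℝ) :
    ∃ R, IsRectangle W 2 R ∧ ∀ y ∈ unitSquare, |y i' - a * y i - b| ≤ W / 2 → y ∈ R := by
  set n := Real.sqrt (1 + a ^ 2) with hn
  have hn2 : n ^ 2 = 1 + a ^ 2 := Real.sq_sqrt (by positivity)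
  have hn0 : 0 < n := Real.sqrt_pos.2 (by positivity)
  have hn1 : 1 ≤ n := by nlinarith [sq_nonneg a]
  have han : |a| ≤ n := by
    refine abs_le_of_sq_le_sq' ?_ hn0.le |>.2
    rw [sq_abs, hn2]
    linarith
  set e := mkPoint i (-a / n) (1 / n) with he
  set f := mkPoint i (1 / n) (a / n) with hf
  have ei : e i = -a / n := mkPoint_apply_self _ _ _
  have ei' : e i' = 1 / n := mkPoint_apply_of_ne h _ _
  have fi : f i = 1 / n := mkPoint_apply_self _ _ _
  have fi' : f i' = a / n := mkPoint_apply_of_ne h _ _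
  have hne : ∀ y : Plane, ‖y‖ ^ 2 = 1 → ‖y‖ = 1 := fun y hy =>
    (pow_eq_one_iff_of_nonneg (norm_nonneg y) (by norm_num)).1 hy
  set s := b / n - (1 / 2 * (-a / n) + 1 / 2 * (1 / n)) with hs
  set x := mkPoint i (1 / 2 + s * (-a / n)) (1 / 2 + s * (1 / n)) with hx
  have xi : x i = 1 / 2 + s * (-a / n) := mkPoint_apply_self _ _ _
  have xi' : x i' = 1 / 2 + s * (1 / n) := mkPoint_apply_of_ne h _ _
  have hunit : (-a / n) * (-a / n) + 1 / n * (1 / n) = 1 := by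
    field_simp
    rw [hn2]
    ring
  refine ⟨_, ⟨x, e, f, hne e ?_, hne f ?_, ?_, rfl⟩, ?_⟩
  · rw [norm_sq_eq_coord h, ei, ei']
    linear_combination hunit
  · rw [norm_sq_eq_coord h, fi, fi']
    linear_combination hunit
  · rw [inner_eq_coord h, ei, ei', fi, fi']
    ring
  · intro y hy hyW
    have hyi := hy i
    have hyi' := hy i'
    constructor
    · rw [inner_eq_coord h]
      simp only [PiLp.sub_apply, ei, ei', xi, xi']
      have e1 : (y i - (1 / 2 + s * (-a / n))) * (-a / n) + (y i' - (1 / 2 + s * (1 / n))) * (1 / n)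
          = (y i' - a * y i - b) / n := by
        have : (y i - (1 / 2 + s * (-a / n))) * (-a / n)
            + (y i' - (1 / 2 + s * (1 / n))) * (1 / n)
            = (y i - 1 / 2) * (-a / n) + (y i' - 1 / 2) * (1 / n)
              - s * ((-a / n) * (-a / n) + 1 / n * (1 / n)) := by ring
        rw [this, hunit, hs]
        ring
      rw [e1, abs_div, abs_of_pos hn0]
      exact (div_le_self (abs_nonneg _) hn1).trans hyW
    · rw [inner_eq_coord h]
      simp only [PiLp.sub_apply, fi, fi', xi, xi']
      have e1 : (y i - (1 / 2 + s * (-a / n))) * (1 / n) + (y i' - (1 / 2 + s * (1 / n))) * (a / n)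
          = ((y i - 1 / 2) + (y i' - 1 / 2) * a) / n := by ring
      rw [e1, abs_div, abs_of_pos hn0, div_le_iff₀ hn0]
      have h1 : |y i - 1 / 2| ≤ 1 / 2 := abs_le.2 ⟨by linarith [hyi.1], by linarith [hyi.2]⟩
      have h2 : |y i' - 1 / 2| ≤ 1 / 2 := abs_le.2 ⟨by linarith [hyi'.1], by linarith [hyi'.2]⟩
      have h3 := abs_add_le (y i - 1 / 2) ((y i' - 1 / 2) * a)
      rw [abs_mul] at h3
      have h4 : |y i' - 1 / 2| * |a| ≤ 1 / 2 * n := by gcongr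
      linarith

/-- The number of tubes of a tube set whose core lines lie in a square of side `2w`. -/
theorem IsTubeSet.card_lines_le {δ v Kv : ℝ} {T T' : Finset (Set Plane)} (hT : IsTubeSet δ v Kv T)
    (hT' : T' ⊆ T) (hδ : 0 < δ) (hδ1 : δ ≤ 1) (hv : 0 ≤ v) (hKv : 0 ≤ Kv) {i i' : Fin 2}
    (h : i ≠ i') {ℓ : Set Plane → ℝ × ℝ} (hℓ : ∀ t ∈ T', IsCoreLine i i' δ t (ℓ t)) (z : ℝ × ℝ)
    {w : ℝ} (hw : δ / 32 ≤ w) :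
    ((T'.filter (fun t => z ∈ closedBall (ℓ t) w)).card : ℝ) ≤ Kv * (128 * w * δ⁻¹) ^ v := by
  have key : ∀ W ∈ Icc δ 1, W ≤ 128 * w → ∀ a b : ℝ,
      (∀ t ∈ T', z ∈ closedBall (ℓ t) w → ∀ y ∈ t, |y i' - a * y i - b| ≤ W / 2) →
      ((T'.filter (fun t => z ∈ closedBall (ℓ t) w)).card : ℝ) ≤ Kv * (128 * w * δ⁻¹) ^ v := by
    intro W hW hWw a b hab
    obtain ⟨R, hR, hsub⟩ := exists_rectangle h a b W
    calc _ ≤ ((T.filter (fun t => t ⊆ R)).card : ℝ) := by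
          refine Nat.cast_le.2 (Finset.card_le_card fun t ht => ?_)
          rw [Finset.mem_filter] at ht ⊢
          exact ⟨hT' ht.1, fun y hy =>
            hsub y (hT.subset_square t (hT' ht.1) hy) (hab t ht.1 ht.2 y hy)⟩
      _ ≤ Kv * (W / δ) ^ v := hT.spacing W hW R hR
      _ ≤ Kv * (128 * w * δ⁻¹) ^ v := by
          rw [div_eq_mul_inv]
          have : 0 ≤ W := hδ.le.trans hW.1
          gcongr
  rcases le_total (128 * w) 1 with h1 | h1
  -- The tubes lie within `δ + 2 w ≤ 34 w` of the line `z`, measured vertically. When `128 w ≥ 1`, a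
  -- strip of width `1` already contains the square.
  · refine key (128 * w) ⟨by linarith, h1⟩ le_rfl z.1 z.2 fun t ht hz y hy => ?_
    have h2 := (hℓ t ht).2 y hy
    rw [mem_closedBall, dist_eq_norm] at hz
    have h3 : |z.1 - (ℓ t).1| ≤ w := (norm_fst_le (z - ℓ t)).trans hz
    have h4 : |z.2 - (ℓ t).2| ≤ w := (norm_snd_le (z - ℓ t)).trans hz
    have hyi := hT.subset_square t (hT' ht) hy i
    have h5 : |(z.1 - (ℓ t).1) * y i| ≤ w := by
      rw [abs_mul, abs_of_nonneg hyi.1]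
      exact (mul_le_of_le_one_right (abs_nonneg _) hyi.2).trans h3
    rw [abs_le] at *
    constructor <;> linarith [h2.1, h2.2, h4.1, h4.2, h5.1, h5.2]
  · refine key 1 ⟨hδ1, le_rfl⟩ h1 0 (1 / 2) fun t ht _ y hy => ?_
    have hyi' := hT.subset_square t (hT' ht) hy i'
    exact abs_le.2 ⟨by linarith [hyi'.1], by linarith [hyi'.2]⟩

/-- The centre of a ball of radius `δ`. -/
def centre (δ : ℝ) (p : Set Plane) : Plane := if h : IsBall δ p then h.choose else 0

theorem IsBall.eq_closedBall {δ : ℝ} {p : Set Plane} (h : IsBall δ p) :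
    p = closedBall (centre δ p) δ := by
  rw [centre, dif_pos h]
  exact h.choose_spec

theorem IsBall.centre_mem {δ : ℝ} (hδ : 0 ≤ δ) {p : Set Plane} (h : IsBall δ p) :
    centre δ p ∈ p := by
  have : centre δ p ∈ closedBall (centre δ p) δ := mem_closedBall_self hδ
  rwa [← h.eq_closedBall] at this

theorem IsBallSet.card_points_le {δ u Ku : ℝ} {S : Finset (Set Plane)} (hS : IsBallSet δ u Ku S)
    (hδ : 0 < δ) (hδ1 : δ ≤ 1) (hu : 0 ≤ u) (hKu : 0 ≤ Ku) {i i' : Fin 2} (h : i ≠ i') (x y : ℝ)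
    {w : ℝ} (hw : δ / 32 ≤ w) :
    ((S.filter (fun p => |centre δ p i - x| ≤ w ∧ |centre δ p i' - y| ≤ w)).card : ℝ)
      ≤ Ku * (128 * w * δ⁻¹) ^ u := by
  have key : ∀ W ∈ Icc δ 1, W ≤ 128 * w → ∀ c : Plane,
      (∀ p ∈ S, |centre δ p i - x| ≤ w → |centre δ p i' - y| ≤ w → p ⊆ closedBall c W) →
      ((S.filter (fun p => |centre δ p i - x| ≤ w ∧ |centre δ p i' - y| ≤ w)).card : ℝ)
        ≤ Ku * (128 * w * δ⁻¹) ^ u := by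
    intro W hW hWw c hc
    calc _ ≤ ((S.filter (fun p => p ⊆ closedBall c W)).card : ℝ) := by
          refine Nat.cast_le.2 (Finset.card_le_card (Finset.monotone_filter_right _ fun p hp hp' =>
            hc p hp hp'.1 hp'.2))
      _ ≤ Ku * (W / δ) ^ u := hS.spacing W hW _ ⟨c, rfl⟩
      _ ≤ Ku * (128 * w * δ⁻¹) ^ u := by
          rw [div_eq_mul_inv]
          have : 0 ≤ W := hδ.le.trans hW.1
          gcongr
  rcases le_total (128 * w) 1 with h1 | h1
  · refine key (128 * w) ⟨by linarith, h1⟩ le_rfl (mkPoint i x y) fun p hp hpx hpy => ?_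
    rw [(hS.isBall p hp).eq_closedBall]
    refine closedBall_subset_closedBall' ?_
    rw [dist_eq_norm]
    have h2 := norm_le_coord h (centre δ p - mkPoint i x y)
    simp only [PiLp.sub_apply, mkPoint_apply_self, mkPoint_apply_of_ne h] at h2
    linarith
  · refine key 1 ⟨hδ1, le_rfl⟩ h1 (mkPoint i (1 / 2) (1 / 2)) fun p hp _ _ q hq => ?_
    have hqs := hS.subset_square p hp hq
    rw [mem_closedBall, dist_eq_norm]
    have h2 := norm_le_coord h (q - mkPoint i (1 / 2) (1 / 2))
    simp only [PiLp.sub_apply, mkPoint_apply_self, mkPoint_apply_of_ne h] at h2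
    have h3 : ∀ k, |q k - 1 / 2| ≤ 1 / 2 := fun k =>
      abs_le.2 ⟨by linarith [(hqs k).1], by linarith [(hqs k).2]⟩
    linarith [h3 i, h3 i']

/-- The centres of essentially distinct balls are separated. -/
theorem EssentiallyDistinct.lt_dist {δ : ℝ} (hδ : 0 < δ) {x y : Plane}
    (h : EssentiallyDistinct (closedBall x δ) (closedBall y δ)) : δ / 8 < dist x y := by
  by_contra hd
  rw [not_lt] at hd
  set z := midpoint ℝ x y with hz
  have hzx : dist z x ≤ δ / 16 := by
    rw [hz, dist_midpoint_left]
    norm_num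
    linarith
  have hzy : dist z y ≤ δ / 16 := by
    rw [hz, dist_midpoint_right]
    norm_num
    linarith
  -- If the centres were within `δ / 8`, this common ball would have area above half, since `(15 /
  -- 16) ^ 2 > 1 / 2`.
  have hsub : closedBall z (15 / 16 * δ) ⊆ closedBall x δ ∩ closedBall y δ :=
    subset_inter (closedBall_subset_closedBall' (by linarith))
      (closedBall_subset_closedBall' (by linarith))
  have h1 : volume (closedBall z (15 / 16 * δ)) ≤ volume (closedBall x δ) / 2 :=
    (measure_mono hsub).trans h.1
  have htop : volume (closedBall x δ) ≠ ⊤ := (isCompact_closedBall x δ).measure_lt_top.ne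
  have h2 := ENNReal.toReal_mono (ENNReal.div_ne_top htop (by norm_num)) h1
  rw [ENNReal.toReal_div, ← measureReal_def, ← measureReal_def,
    Measure.addHaar_real_closedBall _ _ (by positivity),
    Measure.addHaar_real_closedBall _ _ hδ.le] at h2
  have hV : 0 < volume.real (ball (0 : Plane) 1) :=
    ENNReal.toReal_pos (measure_ball_pos _ _ one_pos).ne' measure_ball_lt_top.ne
  have hfin : Module.finrank ℝ Plane = 2 := by simp [Plane]
  rw [hfin] at h2
  norm_num at h2
  nlinarith [mul_pos (pow_pos hδ 2) hV]

/-- The tubes of a Furstenberg set which point roughly in the direction of the coordinate `i`, and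
the balls which they meet, give a configuration of lines and points. -/
theorem isConfiguration_of_isCoreLine {c δ u v Ku Kv : ℝ} (hc : 0 < c) (hu : 0 < u) (hv : 1 ≤ v)
    (hδ : 0 < δ) (hδ1 : δ ≤ 1) (hKu : 1 ≤ Ku) (hKv : 1 ≤ Kv) {P : Finset (Set Plane)}
    (hPdist : (P : Set (Set Plane)).Pairwise EssentiallyDistinct) {T T' : Finset (Set Plane)}
    (hT : IsTubeSet δ v Kv T) (hT' : T' ⊆ T)
    (hS : ∀ t ∈ T, IsBallSet δ u Ku (meeting P t) ∧
      c * (Ku⁻¹ * δ⁻¹ ^ u) ≤ ((meeting P t).card : ℝ))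
    (hcard : c / 2 * δ⁻¹ ^ v ≤ (T'.card : ℝ)) {i i' : Fin 2} (h : i ≠ i')
    {ℓ : Set Plane → ℝ × ℝ} (hℓ : ∀ t ∈ T', IsCoreLine i i' δ t (ℓ t)) :
    IsConfiguration (c / 2) δ u v Ku Kv T' ℓ (T'.biUnion (meeting P)) (fun p => centre δ p i)
      (fun p => centre δ p i') (meeting P) := by
  -- Only balls that meet a tube are known to lie in the unit square, hence the union in place of
  -- `P`.
  have hball : ∀ p ∈ T'.biUnion (meeting P), IsBall δ p ∧ p ⊆ unitSquare := by
    intro p hp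
    obtain ⟨t, ht, hpt⟩ := Finset.mem_biUnion.1 hp
    exact ⟨(hS t (hT' ht)).1.isBall p hpt, (hS t (hT' ht)).1.subset_square p hpt⟩
  have hPmem : ∀ p ∈ T'.biUnion (meeting P), p ∈ P := by
    intro p hp
    obtain ⟨t, _, hpt⟩ := Finset.mem_biUnion.1 hp
    exact (Finset.mem_filter.1 hpt).1
  have hmem : ∀ k, ∀ p ∈ T'.biUnion (meeting P), centre δ p k ∈ Icc (0 : ℝ) 1 := fun k p hp =>
    (hball p hp).2 ((hball p hp).1.centre_mem hδ.le) k
  refine ⟨fun t ht => (hℓ t ht).1, hmem i, hmem i', fun t ht => Finset.subset_biUnion_of_mem _ ht,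
    fun t ht p hp => ?_, fun z w hw => hT.card_lines_le hT' hδ hδ1 (by linarith) (by linarith) h
      hℓ z hw, fun t ht x y w hw => ?_, fun p hp q hq hx hy => ?_, hcard, fun t ht => ?_⟩
  · have hpP := Finset.mem_biUnion.2 ⟨t, ht, hp⟩
    obtain ⟨y, hyp, hyt⟩ := (Finset.mem_filter.1 hp).2
    have h1 := (hℓ t ht).2 y hyt
    rw [(hball p hpP).1.eq_closedBall, mem_closedBall, dist_eq_norm] at hyp
    have h2 := (abs_coord_le_norm i (y - centre δ p)).trans hyp
    have h3 := (abs_coord_le_norm i' (y - centre δ p)).trans hyp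
    simp only [PiLp.sub_apply] at h2 h3
    have h4 : |(ℓ t).1 * (y i - centre δ p i)| ≤ δ := by
      rw [abs_mul]
      exact (mul_le_of_le_one_left (abs_nonneg _) (hℓ t ht).1).trans h2
    rw [abs_le] at *
    constructor <;> linarith [h1.1, h1.2, h3.1, h3.2, h4.1, h4.2]
  · exact (hS t (hT' ht)).1.card_points_le hδ hδ1 hu.le (by linarith) h x y hw
  · by_contra hpq
    have hd := hPdist (hPmem p hp) (hPmem q hq) hpq
    rw [(hball p hp).1.eq_closedBall, (hball q hq).1.eq_closedBall] at hd
    have h1 := hd.lt_dist hδ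
    rw [dist_eq_norm] at h1
    have h2 := norm_le_coord h (centre δ p - centre δ q)
    simp only [PiLp.sub_apply] at h2
    linarith
  · refine le_trans ?_ (hS t (hT' ht)).2
    have : 0 < Ku := by linarith
    gcongr
    linarith

theorem exists_orientation {c δ v : ℝ} {T : Finset (Set Plane)} (hT : ∀ t ∈ T, IsTube δ t)
    (hcard : c * δ⁻¹ ^ v ≤ (T.card : ℝ)) : ∃ i i' : Fin 2, i ≠ i' ∧
      c / 2 * δ⁻¹ ^ v ≤ ((T.filter (fun t => ∃ ℓ, IsCoreLine i i' δ t ℓ)).card : ℝ) := by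
  by_contra hcon
  push Not at hcon
  have h1 := hcon 0 1 (by decide)
  have h2 := hcon 1 0 (by decide)
  have hsub : T ⊆ T.filter (fun t => ∃ ℓ, IsCoreLine 0 1 δ t ℓ) ∪
      T.filter (fun t => ∃ ℓ, IsCoreLine 1 0 δ t ℓ) := by
    intro t ht
    rw [Finset.mem_union, Finset.mem_filter, Finset.mem_filter]
    exact (hT t ht).exists_isCoreLine.imp (fun h => ⟨ht, h⟩) fun h => ⟨ht, h⟩
  have h3 : (T.card : ℝ) ≤ ((T.filter (fun t => ∃ ℓ, IsCoreLine 0 1 δ t ℓ)).card : ℝ) +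
      ((T.filter (fun t => ∃ ℓ, IsCoreLine 1 0 δ t ℓ)).card : ℝ) := by
    exact_mod_cast (Finset.card_le_card hsub).trans (Finset.card_union_le _ _)
  linarith

end

end Furstenberg

/-! ### The theorem for balls and tubes. -/

theorem mainTheorem5 (ε : ℝ) (hε : 0 < ε) (c : ℝ) (hc : 0 < c) :
    ∃ C : ℝ, 0 < C ∧
      ∀ (u v δ Ku Kv : ℝ), 0 < u → u ≤ 1 → 1 ≤ v → v ≤ 2 → 0 < δ → δ ≤ 1 → 1 ≤ Ku → 1 ≤ Kv →
        ∀ P : Finset (Set Furstenberg.Plane),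
          Furstenberg.IsFurstenbergSet c δ u v Ku Kv P →
            C * Ku ^ (-3 : ℤ) * Kv ^ (-1 : ℤ) * δ⁻¹ ^ (min (2 * u + v - 1) (u + 1) - ε)
              ≤ (P.card : ℝ) := by
  classical
  obtain ⟨C, hC, hmain⟩ := Furstenberg.IsConfiguration.exists_const ε hε (c / 2) (by positivity)
  refine ⟨C, hC, fun u v δ Ku Kv hu hu1 hv hv2 hδ hδ1 hKu hKv P hP => ?_⟩
  obtain ⟨_, hPdist, T, hT, hTcard, hS⟩ := hP
  obtain ⟨i, i', hii, hcard⟩ := Furstenberg.exists_orientation hT.isTube hTcard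
  -- The core line is chosen for every set, with the junk value `0` off the selected tubes, so that
  -- `ℓ` is a total function.
  have hex : ∀ t, ∃ ℓ, t ∈ T.filter (fun t => ∃ ℓ, Furstenberg.IsCoreLine i i' δ t ℓ) →
      Furstenberg.IsCoreLine i i' δ t ℓ := fun t => by
    by_cases ht : t ∈ T.filter (fun t => ∃ ℓ, Furstenberg.IsCoreLine i i' δ t ℓ)
    · obtain ⟨ℓ, hℓ⟩ := (Finset.mem_filter.1 ht).2
      exact ⟨ℓ, fun _ => hℓ⟩
    · exact ⟨0, fun h => absurd h ht⟩
  choose ℓ hℓ using hex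
  have hconf := Furstenberg.isConfiguration_of_isCoreLine hc hu hv hδ hδ1 hKu hKv hPdist hT
    (Finset.filter_subset _ _) hS (by convert hcard) hii hℓ
  refine (hmain u v δ Ku Kv hu hu1 hv hv2 hδ hδ1 hKu hKv hconf).trans ?_
  refine Nat.cast_le.2 (Finset.card_le_card (Finset.biUnion_subset.2 fun t _ => ?_))
  exact Finset.filter_subset _ _
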